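/- Let $k$ be a field of characteristic $\neq 2$ containing a primitive fourth root of unity $\sqrt{-1}$. Let $C=(y^2z=x(x^2-z^2))\subset\mathbb{P}^2_k$, with the automorphism $g$ of order $4$ given by $g^*(x:y:z)=(-x:\sqrt{-1}\,y:z)$, let $Z=C\times_k C\times_k C$ with the diagonal automorphism $(g,g,g)$, again denoted $g$, let $Y=Z/\langle g\rangle$, and let $X$ be the blow-up of $Y$ along the (reduced) set of its singular points. Let $H\subset\mathbb{A}^4=\operatorname{Spec}k[a,b,\alpha,\beta]$ be the affine hypersurface $$(a^2-b)(\alpha^2-\beta^3)=(\alpha^2-\beta)(a^2-b^3),$$ and let $p:H\to\mathbb{A}^2=\operatorname{Spec}k[b,\beta]$ be the projection $(a,b,\alpha,\beta)\mapsto(b,\beta)$. (1) $H$ is equivalently defined by $$a^2\beta(1-\beta^2)=\alpha^2b(1-b^2)+b\beta(b^2-\beta^2),$$ that is, the two equations generate the same ideal of $k[a,b,\alpha,\beta]$. (2) $p$ is a conic bundle: its generic fibre is isomorphic, over $\kappa(\eta)=k(b,\beta)$, to a plane affine conic whose $3\times3$ symmetric matrix is nondegenerate (so that its projective closure is a smooth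 conic). (3) $X$ is birationally equivalent to $H$ over $k$, by a birational map $\varphi:X\dashrightarrow H$ for which the composite rational map $p\circ\varphi:X\dashrightarrow\mathbb{A}^2$ makes $X$ birationally a conic bundle over the plane: the generic fibre of $p\circ\varphi$ is birational over $k(b,\beta)$ to a plane conic with nondegenerate symmetric matrix. -/

import Mathlib

open CategoryTheory CategoryTheory.Limits AlgebraicGeometry MvPolynomial

universe u

noncomputable section

namespace UenoCampana

/-! ### The harmonic elliptic curve `C = (y² z = x (x² - z²)) ⊂ ℙ²` -/

section Curve

attribute [local instance] MvPolynomial.gradedAlgebra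

variable (k : Type u) [Field k]

/-- The cubic form `y² z - x (x² - z²)`, with `x = X 0`, `y = X 1`, `z = X 2`. -/
def cubic : MvPolynomial (Fin 3) k :=
  X 1 ^ 2 * X 2 - X 0 * (X 0 ^ 2 - X 2 ^ 2)

/-- The homogeneous coordinate ring `k[x, y, z] / (y² z - x (x² - z²))`. -/
abbrev CoordRing : Type u := MvPolynomial (Fin 3) k ⧸ Ideal.span {cubic k}

/-- The degree `n` part of the homogeneous coordinate ring: classes of forms of degree `n`. -/
def grading (n : ℕ) : Submodule k (CoordRing k) :=
  (homogeneousSubmodule (Fin 3) k n).map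
    (Ideal.Quotient.mkₐ k (Ideal.span {cubic k})).toLinearMap

lemma mk_mem_grading {n : ℕ} {p : MvPolynomial (Fin 3) k} (hp : p.IsHomogeneous n) :
    Ideal.Quotient.mk (Ideal.span {cubic k}) p ∈ grading k n :=
  ⟨p, hp, rfl⟩

instance : SetLike.GradedMonoid (grading k) where
  one_mem := mk_mem_grading k (isHomogeneous_one _ _)
  mul_mem := by
    rintro i j _ _ ⟨p, hp, rfl⟩ ⟨q, hq, rfl⟩
    exact mk_mem_grading k (IsHomogeneous.mul hp hq)

lemma cubic_isHomogeneous : (cubic k).IsHomogeneous 3 := by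
  have h (i : Fin 3) : (X i : MvPolynomial (Fin 3) k).IsHomogeneous 1 := isHomogeneous_X _ _
  exact (((h 1).pow 2).mul (h 2)).sub ((h 0).mul (((h 0).pow 2).sub ((h 2).pow 2)))

/-- The class of a form of degree `n`, as an element of the degree `n` part. -/
def gradingMk (n : ℕ) : homogeneousSubmodule (Fin 3) k n →ₗ[k] grading k n :=
  ((Ideal.Quotient.mkₐ k (Ideal.span {cubic k})).toLinearMap.domRestrict _).codRestrict _
    fun p => mk_mem_grading k p.2

/-- The map from the sum of the spaces of forms to the sum of the graded pieces. -/
def sumMk : DirectSum ℕ (fun n => homogeneousSubmodule (Fin 3) k n) →ₐ[k]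
    DirectSum ℕ (fun n => grading k n) :=
  DirectSum.toAlgebra k (fun n => homogeneousSubmodule (Fin 3) k n)
    (fun n => (DirectSum.lof k ℕ (fun n => grading k n) n).comp (gradingMk k n)) rfl
    (fun {i j} p q => by
      simp only [LinearMap.comp_apply, DirectSum.lof_eq_of]
      rw [DirectSum.of_mul_of]
      rfl)

lemma sumMk_of (n : ℕ) (p : homogeneousSubmodule (Fin 3) k n) :
    sumMk k (DirectSum.of (fun n => homogeneousSubmodule (Fin 3) k n) n p) =
      DirectSum.of (fun n => grading k n) n (gradingMk k n p) :=
  DirectSum.toAddMonoid_of _ _ _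

/-- The decomposition of a polynomial into the classes of its homogeneous components. -/
def decomposePoly : MvPolynomial (Fin 3) k →ₐ[k] DirectSum ℕ (fun n => grading k n) :=
  (sumMk k).comp (DirectSum.decomposeAlgEquiv (homogeneousSubmodule (Fin 3) k)).toAlgHom

lemma decomposePoly_of_mem {n : ℕ} {p : MvPolynomial (Fin 3) k}
    (hp : p ∈ homogeneousSubmodule (Fin 3) k n) :
    decomposePoly k p = DirectSum.of (fun n => grading k n) n (gradingMk k n ⟨p, hp⟩) :=
  (congrArg (sumMk k) (DirectSum.decompose_of_mem _ hp)).trans (sumMk_of k n ⟨p, hp⟩)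

instance : GradedAlgebra (grading k) :=
  GradedAlgebra.ofAlgHom (grading k)
    (Ideal.Quotient.liftₐ _ (decomposePoly k) (by
      intro p hp
      obtain ⟨q, rfl⟩ := Ideal.mem_span_singleton'.mp hp
      rw [map_mul, decomposePoly_of_mem k (cubic_isHomogeneous k)]
      have : gradingMk k 3 ⟨cubic k, cubic_isHomogeneous k⟩ = 0 :=
        Subtype.ext (Ideal.Quotient.eq_zero_iff_mem.mpr (Ideal.mem_span_singleton_self _))
      rw [this, map_zero, mul_zero]))
    (by
      refine Ideal.Quotient.algHom_ext _ (MvPolynomial.algHom_ext fun j => ?_)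
      change DirectSum.coeAlgHom (grading k) (decomposePoly k (X j)) = Ideal.Quotient.mk _ (X j)
      rw [decomposePoly_of_mem k (isHomogeneous_X k j), DirectSum.coeAlgHom_of]
      rfl)
    (by
      rintro n ⟨_, p, hp, rfl⟩
      exact decomposePoly_of_mem k hp)

/-- The projective plane curve `C = Proj k[x, y, z] / (y² z - x (x² - z²))`. -/
abbrev curve : Scheme.{u} := Proj (grading k)

/-- The structure morphism of `C` over `k`. -/
def curveToSpec : curve k ⟶ Spec (.of k) :=
  Proj.toSpecZero (grading k) ≫ Spec.map (CommRingCat.ofHom (algebraMap k (grading k 0)))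

variable {k}

lemma sq_eq_neg_one {i : k} (hi : IsPrimitiveRoot i 4) : i ^ 2 = -1 := by
  have h : (i ^ 2) ^ 2 = 1 := by rw [← pow_mul]; exact hi.pow_eq_one
  exact (sq_eq_one_iff.mp h).resolve_left
    (hi.pow_ne_one_of_pos_of_lt (by norm_num) (by norm_num))

/-- The substitution `x ↦ -x`, `y ↦ c y`, `z ↦ z` in polynomials. -/
def subst (c : k) : MvPolynomial (Fin 3) k →ₐ[k] MvPolynomial (Fin 3) k :=
  aeval ![-X 0, C c * X 1, X 2]

lemma subst_isHomogeneous (c : k) {n : ℕ} {p : MvPolynomial (Fin 3) k} (hp : p.IsHomogeneous n) :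
    (subst c p).IsHomogeneous n := by
  rw [← one_mul n]
  refine hp.aeval _ fun j => ?_
  fin_cases j
  · exact (isHomogeneous_X k 0).neg
  · exact isHomogeneous_C_mul_X c 1
  · exact isHomogeneous_X k 2

lemma subst_cubic {c : k} (hc : c ^ 2 = -1) : subst c (cubic k) = -cubic k := by
  simp only [subst, cubic, map_sub, map_mul, map_pow, aeval_X, Matrix.cons_val]
  rw [mul_pow, ← C_pow, hc, C_neg, C_1]
  ring

lemma subst_subst {c d : k} (h : c * d = 1) (p : MvPolynomial (Fin 3) k) :
    subst c (subst d p) = p := by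
  have : (subst c).comp (subst d) = AlgHom.id k _ := by
    refine MvPolynomial.algHom_ext fun j => ?_
    fin_cases j
    · simp [subst]
    · simp [subst, ← mul_assoc, ← C_mul, mul_comm d c, h]
    · simp [subst]
  exact DFunLike.congr_fun this p

/-- The ring endomorphism `x ↦ -x`, `y ↦ i y`, `z ↦ z` of the homogeneous coordinate ring. -/
def coordRingHom (i : k) (hi : IsPrimitiveRoot i 4) : CoordRing k →ₐ[k] CoordRing k :=
  Ideal.quotientMapₐ _ (subst i) (by
    rw [Ideal.span_singleton_le_iff_mem, Ideal.mem_comap]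
    change subst i (cubic k) ∈ _
    rw [subst_cubic (sq_eq_neg_one hi)]
    exact neg_mem (Ideal.mem_span_singleton_self _))

/-- The same endomorphism, as a homomorphism of graded rings. -/
def gradedHom (i : k) (hi : IsPrimitiveRoot i 4) : grading k →+*ᵍ grading k where
  __ := (coordRingHom i hi).toRingHom
  map_mem := by
    rintro n _ ⟨p, hp, rfl⟩
    exact mk_mem_grading k (subst_isHomogeneous i hp)

lemma irrelevant_le (i : k) (hi : IsPrimitiveRoot i 4) :
    HomogeneousIdeal.irrelevant (grading k) ≤
      (HomogeneousIdeal.irrelevant (grading k)).map (gradedHom i hi) := by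
  rw [HomogeneousIdeal.irrelevant_le]
  rintro n hn _ ⟨p, hp, rfl⟩
  have h : i * -i = 1 := by rw [mul_neg, ← sq, sq_eq_neg_one hi, neg_neg]
  have h2 := Ideal.mem_map_of_mem (gradedHom i hi)
    (HomogeneousIdeal.mem_irrelevant_of_mem (grading k) hn
      (mk_mem_grading k (subst_isHomogeneous (-i) hp)))
  change Ideal.Quotient.mk _ (subst i (subst (-i) p)) ∈ _ at h2
  rw [subst_subst h] at h2
  exact h2

/-- The automorphism `g` of `C` of order four with `g^*(x : y : z) = (-x : i y : z)`. -/
def curveAut (i : k) (hi : IsPrimitiveRoot i 4) : curve k ⟶ curve k :=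
  Proj.map (gradedHom i hi) (irrelevant_le i hi)

lemma awayι_curveAut_toSpec (i : k) (hi : IsPrimitiveRoot i 4) {n : ℕ} (hn : 0 < n)
    {a : CoordRing k} (ha : a ∈ grading k n) :
    Proj.awayι (grading k) (gradedHom i hi a) ((gradedHom i hi).2 ha) hn ≫
        curveAut i hi ≫ curveToSpec k =
      Proj.awayι (grading k) (gradedHom i hi a) ((gradedHom i hi).2 ha) hn ≫ curveToSpec k := by
  rw [curveAut, curveToSpec, Proj.awayι_comp_map_assoc _ _ hn a ha, Proj.awayι_toSpecZero_assoc,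
    Proj.awayι_toSpecZero_assoc, ← Spec.map_comp, ← Spec.map_comp, ← Spec.map_comp]
  congr 1
  ext c
  have h : (gradedHom i hi) (algebraMap k (CoordRing k) c) = algebraMap k (CoordRing k) c :=
    (coordRingHom i hi).commutes c
  change Localization.mk (gradedHom i hi (algebraMap k (CoordRing k) c)) _ =
    Localization.mk (algebraMap k (CoordRing k) c) _
  rw [h]
  congr 1
  exact Subtype.ext (map_one (gradedHom i hi))

lemma curveAut_toSpec (i : k) (hi : IsPrimitiveRoot i 4) :
    curveAut i hi ≫ curveToSpec k = curveToSpec k := by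
  refine (Proj.mapAffineOpenCover _ (irrelevant_le i hi)).openCover.hom_ext _ _ ?_
  rintro ⟨⟨n, hn⟩, a, ha⟩
  exact awayι_curveAut_toSpec i hi hn ha

end Curve

/-! ### The threefold `Z = C × C × C` with the diagonal automorphism -/

section Product

variable (k : Type u) [Field k]

/-- `C × C` over `k`. -/
abbrev surface : Scheme.{u} := pullback (curveToSpec k) (curveToSpec k)

def surfaceToSpec : surface k ⟶ Spec (.of k) := pullback.fst _ _ ≫ curveToSpec k

/-- `Z = (C × C) × C` over `k`. -/
abbrev triple : Scheme.{u} := pullback (surfaceToSpec k) (curveToSpec k)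

def tripleToSpec : triple k ⟶ Spec (.of k) := pullback.fst _ _ ≫ surfaceToSpec k

variable {k}

/-- The automorphism `(g, g)` of `C × C`. -/
def surfaceAut (i : k) (hi : IsPrimitiveRoot i 4) : surface k ⟶ surface k :=
  pullback.map _ _ _ _ (curveAut i hi) (curveAut i hi) (𝟙 _)
    (by rw [curveAut_toSpec, Category.comp_id]) (by rw [curveAut_toSpec, Category.comp_id])

lemma surfaceAut_toSpec (i : k) (hi : IsPrimitiveRoot i 4) :
    surfaceAut i hi ≫ surfaceToSpec k = surfaceToSpec k := by
  rw [surfaceAut, surfaceToSpec, pullback.map, pullback.lift_fst_assoc, Category.assoc,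
    curveAut_toSpec]

/-- The automorphism `(g, g, g)` of `Z = C × C × C`. -/
def tripleAut (i : k) (hi : IsPrimitiveRoot i 4) : triple k ⟶ triple k :=
  pullback.map _ _ _ _ (surfaceAut i hi) (curveAut i hi) (𝟙 _)
    (by rw [surfaceAut_toSpec, Category.comp_id]) (by rw [curveAut_toSpec, Category.comp_id])

end Product

/-! ### Quotients, singular points, blow-ups -/

section General

/-- `q : Z ⟶ Y` is the quotient of `Z` by the cyclic group generated by an automorphism `g` of
finite order: `q` is affine and `g`-invariant, and `𝒪_Y → (q_* 𝒪_Z)^g` is an isomorphism. -/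
structure IsCyclicQuotient {Z Y : Scheme.{u}} (g : Z ⟶ Z) (q : Z ⟶ Y) : Prop where
  isAffineHom : IsAffineHom q
  invariant : g ≫ q = q
  app_injective (U : Y.Opens) : Function.Injective (q.app U)
  exists_app_eq_iff (U : Y.Opens) (s : Γ(Z, q ⁻¹ᵁ U)) :
    (∃ t, q.app U t = s) ↔
      g.appLE (q ⁻¹ᵁ U) (q ⁻¹ᵁ U) (by rw [← Scheme.Hom.comp_preimage, invariant]) s = s

/-- The largest open subscheme of `Y` that is smooth over the base. -/
def smoothOpens {Y S : Scheme.{u}} (f : Y ⟶ S) : Y.Opens :=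
  sSup {U : Y.Opens | Smooth (U.ι ≫ f)}

/-- The closed set of singular points of `Y`: the points without a smooth open neighbourhood. -/
def singularLocus {Y S : Scheme.{u}} (f : Y ⟶ S) : TopologicalSpace.Closeds Y :=
  (smoothOpens f).compl

/-- The ideal sheaf is locally generated by one nonzerodivisor (it is the ideal sheaf of an
effective Cartier divisor). -/
def IsEffectiveCartier {X : Scheme.{u}} (I : X.IdealSheafData) : Prop :=
  ∀ x : X, ∃ U : X.affineOpens, x ∈ U.1 ∧
    ∃ f ∈ nonZeroDivisors Γ(X, U), I.ideal U = Ideal.span {f}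

/-- `σ : X ⟶ Y` is the blow-up of `Y` along the ideal sheaf `I`: the inverse image ideal sheaf
`I · 𝒪_X` is that of an effective Cartier divisor, and `σ` is universal for this property. -/
structure IsBlowUp {X Y : Scheme.{u}} (I : Y.IdealSheafData) (σ : X ⟶ Y) : Prop where
  isEffectiveCartier : IsEffectiveCartier (I.comap σ)
  existsUnique_lift {T : Scheme.{u}} (f : T ⟶ Y) (hf : IsEffectiveCartier (I.comap f)) :
    ∃! h : T ⟶ X, h ≫ σ = f

end General

/-- The Ueno–Campana threefold `X`: the blow-up at its singular points (with reduced structure) of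
the quotient `Y` of `Z = C × C × C` by the cyclic group generated by `g = (g, g, g)`. The quotient
and the blow-up determine all the data up to a unique isomorphism. -/
structure Threefold {k : Type u} [Field k] (i : k) (hi : IsPrimitiveRoot i 4) where
  /-- The quotient `Y = Z / ⟨g⟩`. -/
  Y : Scheme.{u}
  /-- The quotient morphism. -/
  quot : triple k ⟶ Y
  isCyclicQuotient : IsCyclicQuotient (tripleAut i hi) quot
  /-- The structure morphism of `Y` over `k`. -/
  quotToSpec : Y ⟶ Spec (.of k)
  quot_toSpec : quot ≫ quotToSpec = tripleToSpec k
  /-- The threefold `X`. -/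
  X : Scheme.{u}
  /-- The blow-up morphism. -/
  blowUp : X ⟶ Y
  isBlowUp : IsBlowUp
    (Scheme.IdealSheafData.vanishingIdeal (singularLocus quotToSpec)) blowUp

/-- The structure morphism of `X` over `k`. -/
def Threefold.toSpec {k : Type u} [Field k] {i : k} {hi : IsPrimitiveRoot i 4}
    (W : Threefold i hi) : W.X ⟶ Spec (.of k) :=
  W.blowUp ≫ W.quotToSpec

/-! ### The hypersurface `H ⊂ 𝔸⁴ = Spec k[a, b, α, β]` and its projection to `Spec k[b, β]` -/

section Hypersurface

variable (k : Type u) [Field k]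

/-- `(a² - b)(α² - β³) - (α² - β)(a² - b³)`, with `a, b, α, β = X 0, X 1, X 2, X 3`. -/
def hypersurfacePoly : MvPolynomial (Fin 4) k :=
  (X 0 ^ 2 - X 1) * (X 2 ^ 2 - X 3 ^ 3) - (X 2 ^ 2 - X 3) * (X 0 ^ 2 - X 1 ^ 3)

/-- `a² β (1 - β²) - (α² b (1 - b²) + b β (b² - β²))`, with
`a, b, α, β = X 0, X 1, X 2, X 3`. -/
def hypersurfacePoly' : MvPolynomial (Fin 4) k :=
  X 0 ^ 2 * X 3 * (1 - X 3 ^ 2) -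
    (X 2 ^ 2 * X 1 * (1 - X 1 ^ 2) + X 1 * X 3 * (X 1 ^ 2 - X 3 ^ 2))

/-- The coordinate ring of `H`. -/
abbrev HypersurfaceRing : Type u := MvPolynomial (Fin 4) k ⧸ Ideal.span {hypersurfacePoly k}

/-- The affine hypersurface `H`. -/
def hypersurface : Scheme.{u} := Spec (.of (HypersurfaceRing k))

/-- The structure morphism of `H` over `k`. -/
def hypersurfaceToSpec : hypersurface k ⟶ Spec (.of k) :=
  Spec.map (CommRingCat.ofHom (algebraMap k (HypersurfaceRing k)))

/-- The affine plane `Spec k[b, β]`, with `b, β = X 0, X 1`. -/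
abbrev plane : Scheme.{u} := Spec (.of (MvPolynomial (Fin 2) k))

/-- The projection `(a, b, α, β) ↦ (b, β)` restricted to `H`. -/
def projection : hypersurface k ⟶ plane k :=
  Spec.map (CommRingCat.ofHom (aeval (R := k) (S₁ := HypersurfaceRing k)
    ![Ideal.Quotient.mk _ (X 1), Ideal.Quotient.mk _ (X 3)]).toRingHom)

end Hypersurface

/-! ### Conic bundles -/

section Conic

/-- The polynomial `(x, y, 1) M (x, y, 1)ᵗ` in the two affine coordinates `x = X 0`, `y = X 1`. -/
def conicPoly {K : Type u} [CommRing K] (M : Matrix (Fin 3) (Fin 3) K) : MvPolynomial (Fin 2) K :=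
  ![X 0, X 1, 1] ⬝ᵥ (M.map C).mulVec ![X 0, X 1, 1]

/-- The affine plane conic `Spec K[x, y] / ((x, y, 1) M (x, y, 1)ᵗ)`. -/
def conic {K : Type u} [CommRing K] (M : Matrix (Fin 3) (Fin 3) K) : Scheme.{u} :=
  Spec (.of (MvPolynomial (Fin 2) K ⧸ Ideal.span {conicPoly M}))

/-- The structure morphism of the affine plane conic. -/
def conicToSpec {K : Type u} [CommRing K] (M : Matrix (Fin 3) (Fin 3) K) :
    conic M ⟶ Spec (.of K) :=
  Spec.map (CommRingCat.ofHom
    (algebraMap K (MvPolynomial (Fin 2) K ⧸ Ideal.span {conicPoly M})))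

variable {V S : Scheme.{u}} [IrreducibleSpace S]

/-- `p : V ⟶ S` is a conic bundle, with affine fibres: its generic fibre is isomorphic, over the
residue field of the generic point, to an affine plane conic with symmetric matrix of nonzero
determinant, so that (in characteristic not two) the projective closure is a smooth conic. -/
def IsConicBundle (p : V ⟶ S) : Prop :=
  ∃ M : Matrix (Fin 3) (Fin 3) (S.residueField (genericPoint S)), M.IsSymm ∧ M.det ≠ 0 ∧
    ∃ e : p.fiber (genericPoint S) ≅ conic M,
      e.hom ≫ conicToSpec M = p.fiberToSpecResidueField (genericPoint S)

/-- The rational map `V ⇢ S` given by `p` makes `V` birationally a conic bundle: its generic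
fibre is birational, over the residue field of the generic point, to a plane conic with symmetric
matrix of nonzero determinant. -/
def IsBirationallyConicBundle (p : V.PartialMap S) : Prop :=
  ∃ M : Matrix (Fin 3) (Fin 3) (S.residueField (genericPoint S)), M.IsSymm ∧ M.det ≠ 0 ∧
    Scheme.BirationalOver (p.hom.fiberToSpecResidueField (genericPoint S)) (conicToSpec M)

end Conic

end UenoCampana

end

noncomputable section

namespace UenoCampana

/-! On the chart `z ≠ 0` of each factor, `g` acts by `x_j ↦ -x_j`, `y_j ↦ i y_j`, so the ratios `a =
y₂/y₁`, `b = x₂/x₁`, `α = y₃/y₁`, `β = x₃/x₁` are invariant. The curve equations give `x₁² (a² - b³)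
= a² - b` and likewise `x₁² (α² - β³) = α² - β` (`TripleRing.sq_mul_eq`); eliminating `x₁²` yields
the equation of `H`. Conversely, a monomial in the coordinates is invariant when twice its degree in
the `x_j` plus its degree in the `y_j` is divisible by 4. It is then a polynomial in `a, b, α, β`
times a polynomial in `x₁² = (a² - b)/(a² - b³)`. Averaging over the group reduces every invariant
to such monomials (`TripleRing.mem_localRange_of_invariant`). There is no further relation between
`a, b, α, β`: `H` is integral (`prime_hypersurfacePoly`), and after extracting two square roots its
generic point lifts to `C × C × C` (`TripleRing.exists_geometricPoint`). Hence a suitable localized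
ring of invariants is a localization of the coordinate ring of `H`
(`TripleRing.exists_isLocalization`). Geometrically, a nonempty open `V` of `Y` embeds as an open
subscheme of `H` (`exists_chart_of_isCyclicQuotient`). The functions inverted on `V` include the
derivative of the equation with respect to `a`, so `V` is smooth and misses the centre of the
blow-up; the blow-up is an isomorphism over `V`, and the preimage of `V` is dense in `X`. For the
conic structure, the terms `a² α²` cancel on expansion, leaving a diagonal quadratic equation in `a,
α` over `k[b, β]`. Base change to the generic point of the plane gives the conic
(`isConicBundle_projection`), and flatness of the inclusion of that point keeps dense opens dense in
the generic fibre (`birationalOver_fiber`). -/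

lemma hypersurfacePoly_eq (k : Type u) [Field k] : hypersurfacePoly k = hypersurfacePoly' k := by
  rw [hypersurfacePoly, hypersurfacePoly']
  ring

/-! ### Irreducibility of the hypersurface `H`. -/

section Prime

variable (k : Type u) [Field k]

/-- The coefficient of `a²` in the equation of `H`, in the variables `b, α, β = X 0, X 1, X 2`. -/
def leadCoeff : MvPolynomial (Fin 3) k := X 2 * (1 - X 2) * (1 + X 2)

/-- The part of the equation of `H` not involving `a`, up to sign and the factor `b`, in the
variables `b, α, β = X 0, X 1, X 2`. -/
def tailCofactor : MvPolynomial (Fin 3) k := X 1 ^ 2 * (1 - X 0 ^ 2) + X 2 * (X 0 ^ 2 - X 2 ^ 2)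

lemma finSuccEquiv_hypersurfacePoly :
    finSuccEquiv k 3 (hypersurfacePoly k) =
      Polynomial.C (leadCoeff k) * Polynomial.X ^ 2 - Polynomial.C (X 0 * tailCofactor k) := by
  have h1 : finSuccEquiv k 3 (X 1) = Polynomial.C (X 0) := finSuccEquiv_X_succ (j := 0)
  have h2 : finSuccEquiv k 3 (X 2) = Polynomial.C (X 1) := finSuccEquiv_X_succ (j := 1)
  have h3 : finSuccEquiv k 3 (X 3) = Polynomial.C (X 2) := finSuccEquiv_X_succ (j := 2)
  simp only [hypersurfacePoly, map_sub, map_mul, map_pow, finSuccEquiv_X_zero, h1, h2, h3,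
    leadCoeff, tailCofactor, map_add, map_one]
  ring

lemma irreducible_one_add_C_mul_X {n : ℕ} (j : Fin n) {c : k} (hc : c ≠ 0) :
    Irreducible (1 + C c * X j : MvPolynomial (Fin n) k) := by
  rw [add_comm]
  refine irreducible_mul_X_add _ _ j (by simpa using hc) (by simp) (by simp) ?_
  exact isRelPrime_one_right

/-- A polynomial vanishing on a line parallel to the `b`-axis is prime to the terms of the equation
of `H` not involving `a`, if these do not vanish where the line meets `b = 0`. -/
lemma isRelPrime_tail {p : MvPolynomial (Fin 3) k} (hp : Irreducible p) (c d : k)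
    (h0 : aeval ![Polynomial.X, Polynomial.C c, Polynomial.C d] p = (0 : Polynomial k))
    (hcd : c ^ 2 - d ^ 3 ≠ 0) : IsRelPrime p (X 0 * tailCofactor k) := by
  rw [hp.isRelPrime_iff_not_dvd]
  rintro ⟨q, hq⟩
  have h := congrArg (aeval ![Polynomial.X, Polynomial.C c, Polynomial.C d]) hq
  rw [map_mul, map_mul, h0, zero_mul] at h
  rcases mul_eq_zero.mp h with h | h
  · simp at h
  · have := congrArg (Polynomial.eval 0) h
    simp [tailCofactor] at this
    exact hcd (by linear_combination this)

lemma isRelPrime_leadCoeff : IsRelPrime (leadCoeff k) (X 0 * tailCofactor k) := by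
  -- The factors `β`, `1 - β`, `1 + β` vanish on the lines `(α, β) = (1, 0), (0, 1), (0, -1)`, where
  -- `α² - β³` equals `1`, `-1`, `1`.
  refine ((isRelPrime_tail k (X_prime (R := k)).irreducible 1 0 (by simp) (by simp)).mul_left
    ?_).mul_left ?_
  · have := irreducible_one_add_C_mul_X k (n := 3) 2 (c := -1) (by simp)
    rw [C_neg, C_1, neg_one_mul, ← sub_eq_add_neg] at this
    exact isRelPrime_tail k this 0 1 (by simp) (by simp)
  · have := irreducible_one_add_C_mul_X k (n := 3) 2 (c := 1) (by simp)
    rw [C_1, one_mul] at this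
    exact isRelPrime_tail k this 0 (-1) (by simp) (by ring_nf; simp)

lemma leadCoeff_ne_zero : leadCoeff k ≠ 0 := by
  have h1 := (irreducible_one_add_C_mul_X k (n := 3) 2 (c := -1) (by simp)).ne_zero
  have h2 := (irreducible_one_add_C_mul_X k (n := 3) 2 (c := 1) (by simp)).ne_zero
  rw [C_neg, C_1, neg_one_mul, ← sub_eq_add_neg] at h1
  rw [C_1, one_mul] at h2
  exact mul_ne_zero (mul_ne_zero (X_ne_zero _) h1) h2

lemma not_X_dvd {p : MvPolynomial (Fin 3) k} (v : Fin 3 → k) (hv : v 0 = 0) (h : eval v p ≠ 0) :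
    ¬ X 0 ∣ p := by
  rintro ⟨q, rfl⟩
  simp [hv] at h

/-- As a polynomial in `a` this is `A a² - b t`, which is Eisenstein at `b`: neither `A = β (1 -
β²)` nor `t` is divisible by `b`, since `t` becomes `α² - β³` at `b = 0`. Primitivity is the
coprimality of `A` and `b t`. -/
lemma prime_hypersurfacePoly : Prime (hypersurfacePoly k) := by
  rw [← MulEquiv.prime_iff (finSuccEquiv k 3), finSuccEquiv_hypersurfacePoly]
  rw [← irreducible_iff_prime]
  set A := leadCoeff k
  set G := X 0 * tailCofactor k
  have hA : A ≠ 0 := leadCoeff_ne_zero k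
  have hdeg : (Polynomial.C A * Polynomial.X ^ 2 - Polynomial.C G).natDegree = 2 := by
    compute_degree!
  have hX : Prime (X 0 : MvPolynomial (Fin 3) k) := X_prime
  refine Polynomial.IsEisensteinAt.irreducible (𝓟 := Ideal.span {X 0}) ⟨?_, ?_, ?_⟩
    ((Ideal.span_singleton_prime hX.ne_zero).mpr hX) ?_ (by rw [hdeg]; norm_num)
  · rw [Polynomial.leadingCoeff, hdeg, Ideal.mem_span_singleton]
    simp only [Polynomial.coeff_sub, Polynomial.coeff_C_mul, Polynomial.coeff_X_pow,
      Polynomial.coeff_C]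
    simp only [↓reduceIte, mul_one, OfNat.ofNat_ne_zero, sub_zero, A, leadCoeff]
    intro h
    rcases hX.dvd_or_dvd h with h | h
    · rcases hX.dvd_or_dvd h with h | h
      · exact not_X_dvd k ![0, 0, 1] rfl (by simp) h
      · exact not_X_dvd k ![0, 0, 0] rfl (by simp) h
    · exact not_X_dvd k ![0, 0, 0] rfl (by simp) h
  · intro n hn
    rw [hdeg] at hn
    rw [Ideal.mem_span_singleton]
    interval_cases n <;> simp [Polynomial.coeff_C, Polynomial.coeff_X_pow, G]
  · rw [Ideal.span_singleton_pow, Ideal.mem_span_singleton]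
    simp only [Polynomial.coeff_sub, Polynomial.coeff_C_mul, Polynomial.coeff_X_pow,
      Polynomial.coeff_C, G]
    simp only [OfNat.zero_ne_ofNat, ↓reduceIte, mul_zero, zero_sub, dvd_neg, sq]
    intro h
    exact not_X_dvd k ![0, 1, 0] rfl (by simp [tailCofactor])
      ((mul_dvd_mul_iff_left hX.ne_zero).mp h)
  · intro c hc
    rw [Polynomial.C_dvd_iff_dvd_coeff] at hc
    have h2 := hc 2
    have h0 := hc 0
    simp [Polynomial.coeff_C, Polynomial.coeff_X_pow] at h2 h0
    exact isRelPrime_leadCoeff k h2 h0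

instance : IsDomain (HypersurfaceRing k) := by
  have := (Ideal.span_singleton_prime (prime_hypersurfacePoly k).ne_zero).mpr
    (prime_hypersurfacePoly k)
  exact Ideal.Quotient.isDomain _

end Prime

/-! ### The base change of `H` along a map from `k[b, β]` as a conic. -/

section GenericFibre

variable (k : Type u) [Field k]

/-- The inclusion of the coordinate ring of the plane into the coordinate ring of `H`. -/
abbrev planeToH : MvPolynomial (Fin 2) k →+* HypersurfaceRing k :=
  (aeval (R := k) (S₁ := HypersurfaceRing k)
    ![Ideal.Quotient.mk _ (X 1), Ideal.Quotient.mk _ (X 3)]).toRingHom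

variable {k} {K : Type u} [CommRing K] (f : MvPolynomial (Fin 2) k →+* K)

/-- The matrix of the conic `β (1 - β²) x² - b (1 - b²) y² = b β (b² - β²)`, base changed
along a ring homomorphism from `k[b, β]`. -/
def fibreMatrix : Matrix (Fin 3) (Fin 3) K :=
  Matrix.diagonal ![f (X 1 * (1 - X 1 ^ 2)), -f (X 0 * (1 - X 0 ^ 2)),
    -f (X 0 * X 1 * (X 0 ^ 2 - X 1 ^ 2))]

lemma fibreMatrix_isSymm : (fibreMatrix f).IsSymm := Matrix.isSymm_diagonal _

lemma conicPoly_fibreMatrix : conicPoly (fibreMatrix f) =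
    C (f (X 1 * (1 - X 1 ^ 2))) * X 0 ^ 2 - C (f (X 0 * (1 - X 0 ^ 2))) * X 1 ^ 2
      - C (f (X 0 * X 1 * (X 0 ^ 2 - X 1 ^ 2))) := by
  have : (fibreMatrix f).map (C : K → MvPolynomial (Fin 2) K) = Matrix.diagonal
      ![C (f (X 1 * (1 - X 1 ^ 2))), -C (f (X 0 * (1 - X 0 ^ 2))),
        -C (f (X 0 * X 1 * (X 0 ^ 2 - X 1 ^ 2)))] := by
    rw [fibreMatrix, Matrix.diagonal_map (by simp)]
    congr 1
    ext j : 1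
    fin_cases j <;> simp
  rw [conicPoly, this]
  simp only [Matrix.mulVec_diagonal, dotProduct, Fin.sum_univ_three, Matrix.cons_val]
  ring

lemma fibreMatrix_det_ne_zero [IsDomain K] (hf : Function.Injective f) :
    (fibreMatrix f).det ≠ 0 := by
  have h1 (j : Fin 2) : (1 - X j ^ 2 : MvPolynomial (Fin 2) k) ≠ 0 := fun h => by
    simpa using congrArg (eval 0) h
  have h2 : (X 0 ^ 2 - X 1 ^ 2 : MvPolynomial (Fin 2) k) ≠ 0 := fun h => by
    simpa using congrArg (eval ![1, 0]) h
  have hX (j : Fin 2) : (X j : MvPolynomial (Fin 2) k) ≠ 0 := X_ne_zero j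
  have hf0 {p : MvPolynomial (Fin 2) k} (hp : p ≠ 0) : f p ≠ 0 :=
    (map_ne_zero_iff f hf).mpr hp
  rw [fibreMatrix, Matrix.det_diagonal, Fin.prod_univ_three]
  exact mul_ne_zero (mul_ne_zero (hf0 (mul_ne_zero (hX 1) (h1 1)))
    (neg_ne_zero.mpr (hf0 (mul_ne_zero (hX 0) (h1 0)))))
    (neg_ne_zero.mpr (hf0 (mul_ne_zero (mul_ne_zero (hX 0) (hX 1)) h2)))

/-- The coordinate ring of the affine conic. -/
abbrev ConicRing (M : Matrix (Fin 3) (Fin 3) K) : Type u :=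
  MvPolynomial (Fin 2) K ⧸ Ideal.span {conicPoly M}

lemma conicRing_relation :
    algebraMap K (ConicRing (fibreMatrix f)) (f (X 1 * (1 - X 1 ^ 2))) *
        Ideal.Quotient.mk _ (X 0) ^ 2 -
      algebraMap K _ (f (X 0 * (1 - X 0 ^ 2))) * Ideal.Quotient.mk _ (X 1) ^ 2 -
      algebraMap K _ (f (X 0 * X 1 * (X 0 ^ 2 - X 1 ^ 2))) = 0 := by
  have h : Ideal.Quotient.mk (Ideal.span {conicPoly (fibreMatrix f)})
      (conicPoly (fibreMatrix f)) = 0 :=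
    Ideal.Quotient.eq_zero_iff_mem.mpr (Ideal.mem_span_singleton_self _)
  refine Eq.trans ?_ h
  refine Eq.trans ?_ (congrArg _ (conicPoly_fibreMatrix f)).symm
  simp only [map_sub, map_mul, map_pow]
  rfl

lemma hypersurfaceRing_relation :
    Ideal.Quotient.mk (Ideal.span {hypersurfacePoly k}) (X 0) ^ 2 * Ideal.Quotient.mk _ (X 3) *
        (1 - Ideal.Quotient.mk _ (X 3) ^ 2) -
      (Ideal.Quotient.mk _ (X 2) ^ 2 * Ideal.Quotient.mk _ (X 1) *
          (1 - Ideal.Quotient.mk _ (X 1) ^ 2) +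
        Ideal.Quotient.mk _ (X 1) * Ideal.Quotient.mk _ (X 3) *
          (Ideal.Quotient.mk _ (X 1) ^ 2 - Ideal.Quotient.mk _ (X 3) ^ 2)) = 0 := by
  have h : Ideal.Quotient.mk (Ideal.span {hypersurfacePoly k}) (hypersurfacePoly' k) = 0 := by
    rw [← hypersurfacePoly_eq]
    exact Ideal.Quotient.eq_zero_iff_mem.mpr (Ideal.mem_span_singleton_self _)
  rw [← h]
  simp only [hypersurfacePoly', map_sub, map_add, map_mul, map_pow, map_one]

/-- The ring homomorphism out of the coordinate ring of `H` given by a solution of its equation. -/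
def hypersurfaceLift {T : Type*} [CommRing T] (c : k →+* T) (v : Fin 4 → T)
    (h : v 0 ^ 2 * v 3 * (1 - v 3 ^ 2) -
      (v 2 ^ 2 * v 1 * (1 - v 1 ^ 2) + v 1 * v 3 * (v 1 ^ 2 - v 3 ^ 2)) = 0) :
    HypersurfaceRing k →+* T :=
  Ideal.Quotient.lift _ (eval₂Hom c v) (by
    intro p hp
    obtain ⟨q, rfl⟩ := Ideal.mem_span_singleton'.mp hp
    rw [map_mul, hypersurfacePoly_eq, hypersurfacePoly']
    simp only [map_sub, map_add, map_mul, map_pow, map_one, coe_eval₂Hom, eval₂_X]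
    rw [h, mul_zero])

@[simp]
lemma hypersurfaceLift_X {T : Type*} [CommRing T] (c : k →+* T) (v : Fin 4 → T) (h) (j : Fin 4) :
    hypersurfaceLift c v h (Ideal.Quotient.mk _ (X j)) = v j := by
  simp [hypersurfaceLift]

@[simp]
lemma hypersurfaceLift_algebraMap {T : Type*} [CommRing T] (c : k →+* T) (v : Fin 4 → T) (h)
    (x : k) : hypersurfaceLift c v h (algebraMap k _ x) = c x := by
  change hypersurfaceLift c v h (Ideal.Quotient.mk _ (C x)) = c x
  simp [hypersurfaceLift]

lemma hypersurfaceRing_hom_ext {T : Type*} [CommRing T] {u v : HypersurfaceRing k →+* T}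
    (hc : ∀ x : k, u (algebraMap k _ x) = v (algebraMap k _ x))
    (h : ∀ j, u (Ideal.Quotient.mk _ (X j)) = v (Ideal.Quotient.mk _ (X j))) : u = v :=
  Ideal.Quotient.ringHom_ext (MvPolynomial.ringHom_ext hc h)

lemma planeToH_C (x : k) : planeToH k (C x) = algebraMap k _ x :=
  AlgHom.commutes (aeval (R := k) (S₁ := HypersurfaceRing k)
    ![Ideal.Quotient.mk _ (X 1), Ideal.Quotient.mk _ (X 3)]) x

lemma planeToH_X_zero : planeToH k (X 0) = Ideal.Quotient.mk _ (X 1) := by simp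

lemma planeToH_X_one : planeToH k (X 1) = Ideal.Quotient.mk _ (X 3) := by simp

/-- The homomorphism from the coordinate ring of `H` to that of its base change. -/
def toConicRing : HypersurfaceRing k →+* ConicRing (fibreMatrix f) :=
  hypersurfaceLift ((algebraMap K _).comp (f.comp C))
    ![Ideal.Quotient.mk _ (X 0), algebraMap K _ (f (X 0)), Ideal.Quotient.mk _ (X 1),
      algebraMap K _ (f (X 1))] (by
    have h := conicRing_relation f
    simp only [map_sub, map_mul, map_pow, map_one, Matrix.cons_val] at h ⊢
    linear_combination h)

/-- The homomorphism out of the coordinate ring of the generic fibre given by compatible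
homomorphisms out of the base and the coordinate ring of `H`. -/
def conicRingLift {T : Type*} [CommRing T] (c : K →+* T) (u : HypersurfaceRing k →+* T)
    (h : ∀ p, u (planeToH k p) = c (f p)) : ConicRing (fibreMatrix f) →+* T :=
  Ideal.Quotient.lift _ (eval₂Hom c ![u (Ideal.Quotient.mk _ (X 0)),
    u (Ideal.Quotient.mk _ (X 2))]) (by
    intro p hp
    obtain ⟨q, rfl⟩ := Ideal.mem_span_singleton'.mp hp
    rw [map_mul, conicPoly_fibreMatrix]
    convert mul_zero _
    simp only [map_sub, map_mul, map_pow, coe_eval₂Hom, eval₂_X, eval₂_C, Matrix.cons_val, ← h,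
      map_one, planeToH_X_zero, planeToH_X_one]
    have := congrArg u (hypersurfaceRing_relation (k := k))
    simp only [map_sub, map_add, map_mul, map_pow, map_one, map_zero] at this
    linear_combination this)

/-- Both rings are presented by two variables `a, α` and the same quadratic relation, over `k[b, β]`
and over `K`. The universal property thus reduces to choosing images of `K`, `a` and `α`. -/
lemma isPushout_conicRing :
    IsPushout (CommRingCat.ofHom (planeToH k)) (CommRingCat.ofHom f)
      (CommRingCat.ofHom (toConicRing f))
      (CommRingCat.ofHom (algebraMap K (ConicRing (fibreMatrix f)))) := by
  have w : CommRingCat.ofHom (planeToH k) ≫ CommRingCat.ofHom (toConicRing f) =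
      CommRingCat.ofHom f ≫ CommRingCat.ofHom (algebraMap K (ConicRing (fibreMatrix f))) := by
    rw [← CommRingCat.ofHom_comp, ← CommRingCat.ofHom_comp]
    congr 1
    refine MvPolynomial.ringHom_ext (fun c => ?_) fun j => ?_
    · simp only [RingHom.comp_apply, planeToH_C, toConicRing, hypersurfaceLift_algebraMap]
    · fin_cases j <;> simp [toConicRing]
  have hs (s : PushoutCocone (CommRingCat.ofHom (planeToH k)) (CommRingCat.ofHom f))
      (p : MvPolynomial (Fin 2) k) : s.inl.hom (planeToH k p) = s.inr.hom (f p) :=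
    congrArg (fun g => g.hom p) s.condition
  refine ⟨⟨w⟩, ⟨PushoutCocone.IsColimit.mk w (fun s => CommRingCat.ofHom
    (conicRingLift f s.inr.hom s.inl.hom (hs s))) (fun s => ?_) (fun s => ?_) fun s m h1 h2 => ?_⟩⟩
  · ext : 1
    refine hypersurfaceRing_hom_ext (fun x => ?_) fun j => ?_
    · change conicRingLift f _ _ (hs s) (toConicRing f (algebraMap k _ x)) = _
      rw [toConicRing, hypersurfaceLift_algebraMap, ← planeToH_C]
      refine Eq.trans ?_ (hs s _).symm
      change conicRingLift f _ _ (hs s) (Ideal.Quotient.mk _ (C (f (C x)))) = _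
      simp [conicRingLift]
    · have hC (x : K) : conicRingLift f s.inr.hom s.inl.hom (hs s) (algebraMap K _ x) =
          s.inr.hom x := by
        change conicRingLift f _ _ _ (Ideal.Quotient.mk _ (C _)) = _
        simp [conicRingLift]
      have h0 := hs s (X 0)
      have h1 := hs s (X 1)
      rw [planeToH_X_zero] at h0
      rw [planeToH_X_one] at h1
      change conicRingLift f _ _ (hs s) (toConicRing f (Ideal.Quotient.mk _ (X j))) = _
      rw [toConicRing, hypersurfaceLift_X]
      fin_cases j
      · simp [conicRingLift]
      · exact (hC _).trans h0.symm
      · simp [conicRingLift]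
      · exact (hC _).trans h1.symm
  · ext x : 2
    change conicRingLift f _ _ (hs s) (Ideal.Quotient.mk _ (C x)) = _
    simp [conicRingLift]
  · ext : 1
    refine Ideal.Quotient.ringHom_ext (MvPolynomial.ringHom_ext (fun x => ?_) fun j => ?_)
    · have := congrArg (fun g => g.hom x) h2
      refine Eq.trans this ?_
      simp [conicRingLift]
    · fin_cases j
      · have := congrArg (fun g => g.hom (Ideal.Quotient.mk _ (X 0))) h1
        simp only [CommRingCat.hom_comp, CommRingCat.hom_ofHom, RingHom.comp_apply, toConicRing,
          hypersurfaceLift_X] at this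
        refine Eq.trans this ?_
        simp [conicRingLift]
      · have := congrArg (fun g => g.hom (Ideal.Quotient.mk _ (X 2))) h1
        simp only [CommRingCat.hom_comp, CommRingCat.hom_ofHom, RingHom.comp_apply, toConicRing,
          hypersurfaceLift_X] at this
        refine Eq.trans this ?_
        simp [conicRingLift]

end GenericFibre

/-! ### The generic fibre of the projection. -/

section ConicBundle

variable (k : Type u) [Field k]

/-- The residue field at the zero ideal is the fraction field, a localization of `R`. Injectivity
keeps the determinant of the conic nonzero; flatness is what moves dense opens to the generic fibre.
-/
lemma fromSpecResidueField_of_asIdeal_eq_bot {R : CommRingCat.{u}} [IsDomain R] {x : Spec R}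
    (hx : x.asIdeal = ⊥) :
    Function.Injective (Spec.preimage ((Spec R).fromSpecResidueField x)).hom ∧
      Flat ((Spec R).fromSpecResidueField x) := by
  have : x.asIdeal.IsPrime := x.isPrime
  have : IsFractionRing R x.asIdeal.ResidueField := by
    obtain ⟨I, hI⟩ := x
    obtain rfl : I = ⊥ := hx
    exact inferInstanceAs (IsFractionRing R (⊥ : Ideal R).ResidueField)
  rw [← Scheme.Spec.map_residueFieldIso_inv_eq_fromSpecResidueField]
  constructor
  · rw [← Spec.map_comp, Spec.preimage_map, CommRingCat.hom_comp, RingHom.coe_comp]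
    exact (ConcreteCategory.bijective_of_isIso (Scheme.Spec.residueFieldIso R _).inv).1.comp
      (IsFractionRing.injective R x.asIdeal.ResidueField)
  · have : Flat (Spec.map (CommRingCat.ofHom (algebraMap R x.asIdeal.ResidueField))) := by
      rw [HasRingHomProperty.Spec_iff (P := @Flat)]
      change (algebraMap R x.asIdeal.ResidueField).Flat
      rw [RingHom.flat_algebraMap_iff]
      exact IsLocalization.flat _ (nonZeroDivisors R)
    infer_instance

lemma fromSpecResidueField_genericPoint {R : CommRingCat.{u}} [IsDomain R] :
    Function.Injective
      (Spec.preimage ((Spec R).fromSpecResidueField (genericPoint (Spec R)))).hom ∧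
      Flat ((Spec R).fromSpecResidueField (genericPoint (Spec R))) :=
  fromSpecResidueField_of_asIdeal_eq_bot (by rw [genericPoint_eq_bot_of_affine]; rfl)

theorem isConicBundle_projection : IsConicBundle (projection k) := by
  set η := genericPoint (plane k)
  let f := (Spec.preimage ((plane k).fromSpecResidueField η)).hom
  refine ⟨fibreMatrix f, fibreMatrix_isSymm f, fibreMatrix_det_ne_zero f
    fromSpecResidueField_genericPoint.1, ?_⟩
  have h := isPullback_SpecMap_of_isPushout _ _ _ _ (isPushout_conicRing f)
  have hf : Spec.map (CommRingCat.ofHom f) = (plane k).fromSpecResidueField η :=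
    Spec.map_preimage _
  rw [hf] at h
  exact ⟨h.isoPullback.symm, h.isoPullback_inv_snd⟩


end ConicBundle

/-! ### Passing from a dense open to the generic fibre. -/

section GenericRestriction

/-- Flat morphisms lift generizations, so every point of `X` is a specialization of a point over the
generic point of `Y`, and the latter lies in `U`. -/
lemma dense_preimage_of_flat {X Y : Scheme.{u}} [IrreducibleSpace Y] (f : X ⟶ Y) [Flat f]
    {U : Set Y} (hU : IsOpen U) (hne : U.Nonempty) : Dense (f ⁻¹' U) := by
  intro x
  have hξ : genericPoint Y ⤳ f x := genericPoint_specializes _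
  obtain ⟨x', hx', h⟩ := Flat.generalizingMap f hξ
  refine hx'.mem_closed isClosed_closure (subset_closure ?_)
  rw [Set.mem_preimage, h]
  exact (genericPoint_spec Y).mem_open_set_iff hU |>.mpr (by simpa using hne)

/-- The map of fibres is the base change of `m` along `p.fiberι s`. It is therefore an open
immersion, and it is dominant because `p.fiberι s` is flat and `m` has nonempty open range in the
irreducible `H`. -/
lemma birationalOver_fiber {V H S : Scheme.{u}} [IrreducibleSpace H] (m : V ⟶ H)
    [IsOpenImmersion m] [Nonempty V] (p : H ⟶ S) (s : S) [Flat (S.fromSpecResidueField s)] :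
    Scheme.BirationalOver ((m ≫ p).fiberToSpecResidueField s) (p.fiberToSpecResidueField s) := by
  let j : (m ≫ p).fiber s ⟶ p.fiber s :=
    pullback.lift ((m ≫ p).fiberι s ≫ m) ((m ≫ p).fiberToSpecResidueField s)
      (by rw [Category.assoc]; exact (m ≫ p).fiber_fac s)
  have hj1 : j ≫ p.fiberToSpecResidueField s = (m ≫ p).fiberToSpecResidueField s :=
    pullback.lift_snd _ _ _
  have hj2 : j ≫ p.fiberι s = (m ≫ p).fiberι s ≫ m := pullback.lift_fst _ _ _
  have hj : IsPullback j ((m ≫ p).fiberι s) (p.fiberι s) m := by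
    refine IsPullback.of_right ?_ hj2 (IsPullback.of_hasPullback p _).flip
    change IsPullback (j ≫ p.fiberToSpecResidueField s) _ _ _
    rw [hj1]
    exact (IsPullback.of_hasPullback (m ≫ p) _).flip
  have : IsOpenImmersion j := MorphismProperty.of_isPullback hj.flip ‹_›
  have : Flat (p.fiberι s) :=
    inferInstanceAs (Flat (pullback.fst p (S.fromSpecResidueField s)))
  have : IsDominant j := by
    constructor
    have h : Set.range j = p.fiberι s ⁻¹' Set.range m := by
      rw [← Scheme.Pullback.range_fst (p.fiberι s) m, ← hj.isoPullback_hom_fst,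
        Scheme.Hom.comp_base, TopCat.coe_comp]
      exact hj.isoPullback.hom.surjective.range_comp _
    rw [DenseRange, h]
    exact dense_preimage_of_flat (p.fiberι s) m.opensRange.2 (Set.range_nonempty m)
  exact j.birationalOver _ _ hj1

end GenericRestriction

lemma isBirationallyConicBundle_compHom {k : Type u} [Field k] {X : Scheme.{u}}
    (φ : X.PartialIso (hypersurface k)) [Nonempty φ.source] :
    IsBirationallyConicBundle (φ.toPartialMap.compHom (projection k)) := by
  obtain ⟨M, hM, hdet, e, he⟩ := isConicBundle_projection k
  have : Flat ((plane k).fromSpecResidueField (genericPoint (plane k))) :=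
    fromSpecResidueField_genericPoint.2
  have : IrreducibleSpace (hypersurface k) :=
    inferInstanceAs (IrreducibleSpace (PrimeSpectrum (HypersurfaceRing k)))
  have h := birationalOver_fiber (φ.iso.hom ≫ φ.target.ι) (projection k) (genericPoint (plane k))
  exact ⟨M, hM, hdet, h.trans (e.hom.birationalOver _ _ he)⟩

lemma exists_partialIso {k : Type u} [Field k] {X : Scheme.{u}} (sX : X ⟶ Spec (.of k))
    (U : X.Opens) (hU : Dense (U : Set X)) [Nonempty U] (m : U.toScheme ⟶ hypersurface k)
    [IsOpenImmersion m] (hm : m ≫ hypersurfaceToSpec k = U.ι ≫ sX) :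
    ∃ φ : X.PartialIso (hypersurface k), φ.IsOver sX (hypersurfaceToSpec k) ∧
      IsBirationallyConicBundle (φ.toPartialMap.compHom (projection k)) := by
  have : IrreducibleSpace (hypersurface k) :=
    inferInstanceAs (IrreducibleSpace (PrimeSpectrum (HypersurfaceRing k)))
  let φ : X.PartialIso (hypersurface k) :=
    { source := U
      dense_source := hU
      target := m.opensRange
      dense_target := m.opensRange.2.dense (Set.range_nonempty m)
      iso := m.isoOpensRange }
  have : Nonempty φ.source := ‹_›
  exact ⟨φ, by simp [Scheme.PartialIso.IsOver, φ, hm], isBirationallyConicBundle_compHom φ⟩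

/-! ### Blow-ups away from their centre. -/

section BlowUp

lemma isEffectiveCartier_top {X : Scheme.{u}} :
    IsEffectiveCartier (⊤ : X.IdealSheafData) := by
  intro x
  obtain ⟨U, hU, hx, -⟩ := exists_isAffineOpen_mem_and_subset (x := x) (U := ⊤) trivial
  exact ⟨⟨U, hU⟩, hx, 1, one_mem _, by rw [Ideal.span_singleton_one]; rfl⟩

lemma comap_eq_top {X Y : Scheme.{u}} {I : Y.IdealSheafData} {f : X ⟶ Y}
    (h : ∀ x, f x ∉ I.support) : I.comap f = ⊤ := by
  rw [← Scheme.IdealSheafData.support_eq_bot_iff, Scheme.IdealSheafData.support_comap]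
  ext x
  simpa using h x

/-- Let `f` be a local generator. If `D(g)` lies in the given open set and `D(g f)` is empty, then
`g f` is nilpotent; since `f` is a nonzerodivisor, `g` is nilpotent and `D(g)` is empty too. -/
lemma IsEffectiveCartier.dense_compl_support {X : Scheme.{u}} {I : X.IdealSheafData}
    (hI : IsEffectiveCartier I) : Dense (I.support : Set X)ᶜ := by
  rw [dense_iff_inter_open]
  rintro O hO ⟨x, hx⟩
  obtain ⟨⟨U, hU⟩, hxU, f, hf, hIf⟩ := hI x
  obtain ⟨g, hgO, hxg⟩ := hU.exists_basicOpen_le (V := ⟨O, hO⟩) ⟨x, hx⟩ hxU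
  have hne : X.basicOpen (g * f) ≠ ⊥ := by
    intro h
    obtain ⟨n, hn⟩ := (Scheme.isNilpotent_iff_basicOpen_eq_bot_of_isCompact hU.isCompact _).mpr h
    rw [mul_pow] at hn
    have hg : IsNilpotent g :=
      ⟨n, (mul_right_mem_nonZeroDivisors_eq_zero_iff (pow_mem hf n)).mp hn⟩
    have := (Scheme.isNilpotent_iff_basicOpen_eq_bot_of_isCompact hU.isCompact _).mp hg
    rw [this] at hxg
    exact hxg
  obtain ⟨y, hy⟩ := TopologicalSpace.Opens.ne_bot_iff_nonempty _ |>.mp hne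
  rw [SetLike.mem_coe, Scheme.basicOpen_mul] at hy
  refine ⟨y, hgO hy.1, fun hyI => ?_⟩
  have hyU : y ∈ U := X.basicOpen_le _ hy.1
  rw [SetLike.mem_coe, Scheme.IdealSheafData.mem_support_iff_of_mem (U := ⟨U, hU⟩) hyU, hIf] at hyI
  rw [Scheme.mem_zeroLocus_iff] at hyI
  exact hyI f (Ideal.mem_span_singleton_self f) hy.2

namespace IsBlowUp

variable {X Y : Scheme.{u}} {I : Y.IdealSheafData} {σ : X ⟶ Y}

/-- A blow-up is an isomorphism away from its centre. -/
lemma isIso_morphismRestrict (hσ : IsBlowUp I σ) {V : Y.Opens} (hV : ∀ y ∈ V, y ∉ I.support) :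
    IsIso (σ ∣_ V) := by
  have h1 : I.comap V.ι = ⊤ := comap_eq_top fun x => hV _ x.2
  have h2 : I.comap ((σ ⁻¹ᵁ V).ι ≫ σ) = ⊤ := comap_eq_top fun x => hV _ x.2
  obtain ⟨h, hh, -⟩ := hσ.existsUnique_lift V.ι (by rw [h1]; exact isEffectiveCartier_top)
  -- The centre pulls back to the unit ideal on both `V` and its preimage. Existence of lifts over
  -- `V` gives the candidate inverse; uniqueness over the preimage shows that it is one.
  have hu {a b : (σ ⁻¹ᵁ V).toScheme ⟶ X} (ha : a ≫ σ = (σ ⁻¹ᵁ V).ι ≫ σ)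
      (hb : b ≫ σ = (σ ⁻¹ᵁ V).ι ≫ σ) : a = b :=
    (hσ.existsUnique_lift ((σ ⁻¹ᵁ V).ι ≫ σ)
      (by rw [h2]; exact isEffectiveCartier_top)).unique ha hb
  have hr : Set.range h ⊆ Set.range (σ ⁻¹ᵁ V).ι := by
    rintro _ ⟨v, rfl⟩
    rw [Scheme.Opens.range_ι]
    change σ (h v) ∈ V
    rw [← Scheme.Hom.comp_apply, hh]
    exact v.2
  refine ⟨IsOpenImmersion.lift (σ ⁻¹ᵁ V).ι h hr, ?_, ?_⟩
  · rw [← cancel_mono (σ ⁻¹ᵁ V).ι, Category.assoc, IsOpenImmersion.lift_fac, Category.id_comp]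
    exact hu (by rw [Category.assoc, hh, morphismRestrict_ι]) rfl
  · rw [← cancel_mono V.ι, Category.assoc, morphismRestrict_ι, IsOpenImmersion.lift_fac_assoc, hh,
      Category.id_comp]

/-- A nonempty open of `X` meets the complement of the exceptional divisor, where `σ` is an open
immersion into `Y`. Its image there is a nonempty open of the irreducible `Y`, so it meets `V`. -/
lemma dense_preimage (hσ : IsBlowUp I σ) [IrreducibleSpace Y] {V : Y.Opens}
    (hne : (V : Set Y).Nonempty) : Dense (σ ⁻¹ᵁ V : Set X) := by
  let W : Y.Opens := I.support.compl
  have hW : IsIso (σ ∣_ W) := hσ.isIso_morphismRestrict fun y hy => hy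
  rw [dense_iff_inter_open]
  intro O hO hne'
  obtain ⟨x, hxO, hx⟩ := hσ.isEffectiveCartier.dense_compl_support.inter_open_nonempty O hO hne'
  rw [Scheme.IdealSheafData.support_comap] at hx
  let m : (σ ⁻¹ᵁ W).toScheme ⟶ Y := σ ∣_ W ≫ W.ι
  have hm : m = (σ ⁻¹ᵁ W).ι ≫ σ := morphismRestrict_ι _ _
  have hopen : IsOpen (m '' ((σ ⁻¹ᵁ W).ι ⁻¹' O)) :=
    m.isOpenEmbedding.isOpenMap _ (hO.preimage (σ ⁻¹ᵁ W).ι.continuous)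
  obtain ⟨y, hy, ⟨z, hz, rfl⟩⟩ := nonempty_preirreducible_inter V.2 hopen hne
    ⟨_, ⟨⟨x, hx⟩, hxO, rfl⟩⟩
  refine ⟨(σ ⁻¹ᵁ W).ι z, hz, ?_⟩
  rw [hm] at hy
  exact hy

end IsBlowUp

end BlowUp

/-! ### Affine charts of cyclic quotients. -/

section CyclicQuotient

lemma irreducibleSpace_of_isDominant {X Y : Scheme.{u}} [IrreducibleSpace X] (f : X ⟶ Y)
    [IsDominant f] : IrreducibleSpace Y := by
  have h := ((IrreducibleSpace.isIrreducible_univ X).image f f.continuous.continuousOn).closure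
  rw [Set.image_univ, f.denseRange.closure_range] at h
  exact { isPreirreducible_univ := h.2, toNonempty := ⟨f (genericPoint X)⟩ }

variable {Z Y : Scheme.{u}} {g : Z ⟶ Z} {q : Z ⟶ Y}

/-- The norm, that is, the product of the four translates of `s`, works. Its nonvanishing locus is
an intersection of nonempty opens in an irreducible space. -/
lemma exists_invariant_multiple [IrreducibleSpace Z] (hg : g ≫ g ≫ g ≫ g = 𝟙 Z) {O : Z.Opens}
    (hO : O ≤ g ⁻¹ᵁ O) (s : Γ(Z, O)) (hs : (Z.basicOpen s : Set Z).Nonempty) :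
    ∃ t : Γ(Z, O), g.appLE O O hO t = t ∧ s ∣ t ∧ (Z.basicOpen t : Set Z).Nonempty := by
  have : IsIso g := ⟨g ≫ g ≫ g, hg, by simpa using hg⟩
  have hOne : (O : Set Z).Nonempty := hs.mono (Z.basicOpen_le s)
  set θ := g.appLE O O hO
  have h4 (s : Γ(Z, O)) : θ (θ (θ (θ s))) = s := by
    have : θ ≫ θ ≫ θ ≫ θ = 𝟙 _ := by
      simp only [θ, Scheme.Hom.appLE_comp_appLE, Category.assoc, hg]
      simp only [Scheme.Hom.appLE, Scheme.Hom.id_app]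
      exact Z.presheaf.map_id _
    exact congrArg (fun m => m.hom s) this
  have hmul {a b : Γ(Z, O)} (ha : (Z.basicOpen a : Set Z).Nonempty)
      (hb : (Z.basicOpen b : Set Z).Nonempty) : (Z.basicOpen (a * b) : Set Z).Nonempty := by
    rw [Scheme.basicOpen_mul]
    exact nonempty_preirreducible_inter (Z.basicOpen a).2 (Z.basicOpen b).2 ha hb
  have hθ {a : Γ(Z, O)} (ha : (Z.basicOpen a : Set Z).Nonempty) :
      (Z.basicOpen (θ a) : Set Z).Nonempty := by
    rw [Scheme.basicOpen_appLE]
    exact nonempty_preirreducible_inter O.2 (g ⁻¹ᵁ Z.basicOpen a).2 hOne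
      (ha.preimage g.surjective)
  refine ⟨s * θ s * θ (θ s) * θ (θ (θ s)), ?_, ?_, ?_⟩
  · rw [map_mul, map_mul, map_mul, h4]
    ring
  · exact ⟨θ s * θ (θ s) * θ (θ (θ s)), by ring⟩
  · exact hmul (hmul (hmul hs (hθ hs)) (hθ (hθ hs))) (hθ (hθ (hθ hs)))

namespace IsCyclicQuotient

lemma le_preimage (hq : IsCyclicQuotient g q) (V : Y.Opens) : q ⁻¹ᵁ V ≤ g ⁻¹ᵁ (q ⁻¹ᵁ V) := by
  rw [← Scheme.Hom.comp_preimage, hq.invariant]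

/-- If an open `U` has empty preimage, then `Γ(Y, U)` embeds in the zero ring, so `1 = 0` on `U` and
`U` is empty. -/
lemma isDominant (hq : IsCyclicQuotient g q) : IsDominant q := by
  refine ⟨fun y => mem_closure_iff.mpr fun o ho hy => ?_⟩
  let U : Y.Opens := ⟨o, ho⟩
  by_contra hne
  have hbot : q ⁻¹ᵁ U = ⊥ := by
    ext z
    simp only [TopologicalSpace.Opens.coe_bot, Set.mem_empty_iff_false, iff_false]
    exact fun hz => hne ⟨q z, hz, z, rfl⟩
  have : Subsingleton Γ(Z, q ⁻¹ᵁ U) := by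
    rw [hbot]
    infer_instance
  have := (hq.app_injective U).subsingleton
  have h1 : Y.basicOpen (1 : Γ(Y, U)) = Y.basicOpen (0 : Γ(Y, U)) := by
    rw [Subsingleton.elim (1 : Γ(Y, U)) 0]
  rw [Scheme.basicOpen_of_isUnit _ isUnit_one, Scheme.basicOpen_zero] at h1
  have : y ∈ U := hy
  rw [h1] at this
  exact this

lemma irreducibleSpace [IrreducibleSpace Z] (hq : IsCyclicQuotient g q) : IrreducibleSpace Y := by
  have := hq.isDominant
  exact irreducibleSpace_of_isDominant q

/-- Two norms are used. An invariant function on the preimage of an affine `V₀` descends to `t` and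
cuts out an affine `V₁ ⊆ Y` whose preimage lies in `W`. An invariant multiple `f` of `d` on `W`,
with nonvanishing locus inside that preimage, then descends to `V₁` and cuts out `V`. Thus the
preimage of `V` is a principal open of `W` itself. -/
lemma exists_isAffineOpen [IrreducibleSpace Z] (hq : IsCyclicQuotient g q)
    (hg : g ≫ g ≫ g ≫ g = 𝟙 Z) {W : Z.Opens} (hW : IsAffineOpen W) (hgW : W ≤ g ⁻¹ᵁ W)
    (d : Γ(Z, W)) (hd : (Z.basicOpen d : Set Z).Nonempty) :
    ∃ (f : Γ(Z, W)) (V : Y.Opens), IsAffineOpen V ∧ q ⁻¹ᵁ V = Z.basicOpen f ∧ d ∣ f ∧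
      g.appLE W W hgW f = f ∧ (Z.basicOpen f : Set Z).Nonempty := by
  have := hq.isAffineHom
  have hWne : (W : Set Z).Nonempty := hd.mono (Z.basicOpen_le d)
  obtain ⟨z₀⟩ : Nonempty Z := inferInstance
  obtain ⟨V₀, hV₀, hz₀, -⟩ := exists_isAffineOpen_mem_and_subset (x := q z₀) (U := ⊤) trivial
  obtain ⟨z₁, hz₁, hz₁'⟩ := nonempty_preirreducible_inter W.2 (q ⁻¹ᵁ V₀).2 hWne ⟨z₀, hz₀⟩
  obtain ⟨h₀, hh₀, hzh₀⟩ := (hV₀.preimage q).exists_basicOpen_le (V := W) ⟨z₁, hz₁⟩ hz₁'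
  obtain ⟨h, hh, hdvd, hne⟩ := exists_invariant_multiple hg (hq.le_preimage V₀) h₀ ⟨_, hzh₀⟩
  obtain ⟨t, rfl⟩ := (hq.exists_app_eq_iff V₀ h).mpr hh
  set V₁ := Y.basicOpen t
  have hle : q ⁻¹ᵁ V₁ ≤ W := by
    rw [Scheme.preimage_basicOpen]
    obtain ⟨c, hc⟩ := hdvd
    rw [hc, Scheme.basicOpen_mul]
    exact inf_le_left.trans hh₀
  rw [← Scheme.preimage_basicOpen] at hne
  obtain ⟨z₂, hz₂⟩ := hne
  obtain ⟨f₀, hf₀, hzf₀⟩ := hW.exists_basicOpen_le (V := q ⁻¹ᵁ V₁) ⟨z₂, hz₂⟩ (hle hz₂)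
  obtain ⟨f, hf, hdvd', hne'⟩ := exists_invariant_multiple hg hgW (d * f₀) (by
    rw [Scheme.basicOpen_mul]
    exact nonempty_preirreducible_inter (Z.basicOpen d).2 (Z.basicOpen f₀).2 hd ⟨_, hzf₀⟩)
  let f₁ : Γ(Z, q ⁻¹ᵁ V₁) := Z.presheaf.map (homOfLE hle).op f
  obtain ⟨t₁, ht₁⟩ := (hq.exists_app_eq_iff V₁ f₁).mpr (by
    simp only [f₁, ← CommRingCat.comp_apply, Scheme.Hom.map_appLE]
    nth_rewrite 2 [← hf]
    simp only [← CommRingCat.comp_apply, Scheme.Hom.appLE_map])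
  refine ⟨f, Y.basicOpen t₁, (hV₀.basicOpen t).basicOpen t₁, ?_,
    (Dvd.intro _ rfl).trans hdvd', hf, hne'⟩
  rw [Scheme.preimage_basicOpen, ht₁, Scheme.basicOpen_res, inf_eq_right]
  obtain ⟨c, hc⟩ := hdvd'
  rw [hc, Scheme.basicOpen_mul, Scheme.basicOpen_mul]
  exact inf_le_left.trans (inf_le_right.trans hf₀)

end IsCyclicQuotient

end CyclicQuotient

/-! ### The affine curve `y² = x³ - x` over an arbitrary ring. -/

section AffineCurveRing

/-- The affine curve `y² = x³ - x` over a ring. -/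
def affineCurve (D : Type u) [CommRing D] : WeierstrassCurve D := ⟨0, 0, 0, -1, 0⟩

/-- The coordinate ring of the affine curve `y² = x³ - x` over a ring. -/
abbrev AffineCurveRing (D : Type u) [CommRing D] : Type u :=
  WeierstrassCurve.Affine.CoordinateRing (affineCurve D)

namespace AffineCurveRing

variable {D : Type u} [CommRing D]

/-- The inclusion of the constants. -/
def of : D →+* AffineCurveRing D := (AdjoinRoot.of _).comp Polynomial.C

variable (D) in
/-- The coordinate function `x`. -/
def x : AffineCurveRing D := AdjoinRoot.of _ Polynomial.X

variable (D) in
/-- The coordinate function `y`. -/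
def y : AffineCurveRing D := AdjoinRoot.root _

lemma polynomial_eq : WeierstrassCurve.Affine.polynomial (affineCurve D) =
    Polynomial.X ^ 2 - Polynomial.C (Polynomial.X ^ 3 - Polynomial.X) := by
  simp [WeierstrassCurve.Affine.polynomial, affineCurve, ← sub_eq_add_neg]

variable (D) in
lemma relation : y D ^ 2 = x D ^ 3 - x D := by
  have h := AdjoinRoot.eval₂_root (WeierstrassCurve.Affine.polynomial (affineCurve D))
  simp only [polynomial_eq, Polynomial.eval₂_sub, Polynomial.eval₂_pow, Polynomial.eval₂_X,
    Polynomial.eval₂_C, map_sub, map_pow] at h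
  exact sub_eq_zero.mp h

variable {T : Type*} [CommRing T]

/-- The homomorphism given by a point of the curve. -/
def lift (c : D →+* T) (a b : T) (h : b ^ 2 = a ^ 3 - a) : AffineCurveRing D →+* T :=
  AdjoinRoot.lift (Polynomial.eval₂RingHom c a) b (by
    rw [polynomial_eq, Polynomial.eval₂_sub, Polynomial.eval₂_X_pow, Polynomial.eval₂_C,
      Polynomial.coe_eval₂RingHom, Polynomial.eval₂_sub, Polynomial.eval₂_X_pow,
      Polynomial.eval₂_X, h, sub_self])

@[simp]
lemma lift_of (c : D →+* T) (a b : T) (h) (r : D) : lift c a b h (of r) = c r := by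
  simp [lift, of]

@[simp]
lemma lift_x (c : D →+* T) (a b : T) (h) : lift c a b h (x D) = a := by
  simp [lift, x]

@[simp]
lemma lift_y (c : D →+* T) (a b : T) (h) : lift c a b h (y D) = b := by
  simp [lift, y]

lemma hom_ext {u v : AffineCurveRing D →+* T} (h : ∀ r, u (of r) = v (of r))
    (hx : u (x D) = v (x D)) (hy : u (y D) = v (y D)) : u = v :=
  AdjoinRoot.ringHom_ext (Polynomial.ringHom_ext h hx) hy

/-- The coordinate ring is spanned by the monomials `x^m` and `x^m y`. -/
lemma induction {p : AffineCurveRing D → Prop} (hadd : ∀ a b, p a → p b → p (a + b))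
    (h0 : ∀ r (m : ℕ), p (of r * x D ^ m)) (h1 : ∀ r (m : ℕ), p (of r * x D ^ m * y D))
    (t : AffineCurveRing D) : p t := by
  obtain ⟨a, b, rfl⟩ := WeierstrassCurve.Affine.CoordinateRing.exists_smul_basis_eq t
  have hC (r : D) (m : ℕ) : algebraMap (Polynomial D) (AffineCurveRing D)
      (Polynomial.C r * Polynomial.X ^ m) = of r * x D ^ m := by
    rw [map_mul, map_pow]
    rfl
  refine hadd _ _ ?_ ?_
  · rw [Algebra.smul_def, mul_one]
    induction a using Polynomial.induction_on' with
    | add f g hf hg => rw [map_add]; exact hadd _ _ hf hg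
    | monomial m r => rw [← Polynomial.C_mul_X_pow_eq_monomial, hC]; exact h0 r m
  · rw [Algebra.smul_def]
    induction b using Polynomial.induction_on' with
    | add f g hf hg => rw [map_add, add_mul]; exact hadd _ _ hf hg
    | monomial m r => rw [← Polynomial.C_mul_X_pow_eq_monomial, hC]; exact h1 r m

/-- Functoriality in the ring of constants. -/
def map {D' : Type u} [CommRing D'] (c : D →+* D') : AffineCurveRing D →+* AffineCurveRing D' :=
  lift (of.comp c) (x D') (y D') (relation D')

/-- A map out of the coordinate ring is a map on constants together with a solution of an equation
with integer coefficients, so the construction commutes with base change. Iterating it therefore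
computes charts of products of the curve. -/
lemma isPushout {D' : Type u} [CommRing D'] (c : D →+* D') :
    IsPushout (CommRingCat.ofHom c) (CommRingCat.ofHom (of (D := D)))
      (CommRingCat.ofHom (of (D := D'))) (CommRingCat.ofHom (map c)) := by
  have w : CommRingCat.ofHom c ≫ CommRingCat.ofHom (of (D := D')) =
      CommRingCat.ofHom (of (D := D)) ≫ CommRingCat.ofHom (map c) := by
    ext r
    simp [map]
  refine ⟨⟨w⟩, ⟨PushoutCocone.IsColimit.mk w (fun s => CommRingCat.ofHom
    (lift s.inl.hom (s.inr.hom (x D)) (s.inr.hom (y D)) ?_)) (fun s => ?_) (fun s => ?_)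
      fun s m h1 h2 => ?_⟩⟩
  · rw [← map_pow, relation, map_sub, map_pow]
  · ext r
    simp
  · ext : 1
    refine hom_ext (fun r => ?_) ?_ ?_
    · have := congrArg (fun g => g.hom r) s.condition
      simpa [map] using this
    · simp [map]
    · simp [map]
  · ext : 1
    refine hom_ext (fun r => ?_) ?_ ?_
    · simpa using congrArg (fun g => g.hom r) h1
    · simpa [map] using congrArg (fun g => g.hom (x D)) h2
    · simpa [map] using congrArg (fun g => g.hom (y D)) h2

/-- The endomorphism `x ↦ -x`, `y ↦ e y` covering an endomorphism of the ring of constants. -/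
def twist (c : D →+* D) (e : D) (he : e ^ 2 = -1) : AffineCurveRing D →+* AffineCurveRing D :=
  lift (of.comp c) (-x D) (of e * y D) (by
    rw [mul_pow, ← map_pow, he, relation, map_neg, map_one]
    ring)

end AffineCurveRing

end AffineCurveRing

/-! ### The chart `z ≠ 0` of the projective curve. -/

section Chart

attribute [local instance] MvPolynomial.gradedAlgebra

lemma eval₂_mul_of_isHomogeneous {R S σ : Type*} [CommSemiring R] [CommSemiring S]
    (f : R →+* S) (s : S) (v : σ → S) {p : MvPolynomial σ R} {n : ℕ} (hp : p.IsHomogeneous n) :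
    eval₂ f (fun j => s * v j) p = s ^ n * eval₂ f v p := by
  rw [eval₂_eq, eval₂_eq, Finset.mul_sum]
  refine Finset.sum_congr rfl fun d hd => ?_
  have hn : ∑ j ∈ d.support, d j = n := (hp.degree_eq_sum_deg_support hd).symm
  simp_rw [mul_pow]
  rw [Finset.prod_mul_distrib, Finset.prod_pow_eq_pow_sum, hn]
  ring

variable (k : Type u) [Field k]

/-- Dehomogenization with respect to `z`. -/
def dehomogenize : CoordRing k →+* AffineCurveRing k :=
  Ideal.Quotient.lift _ (eval₂Hom AffineCurveRing.of
    ![AffineCurveRing.x k, AffineCurveRing.y k, 1]) (by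
    intro p hp
    obtain ⟨q, rfl⟩ := Ideal.mem_span_singleton'.mp hp
    rw [map_mul, cubic]
    convert mul_zero _
    simp [AffineCurveRing.relation]
    ring)

lemma dehomogenize_mk (p : MvPolynomial (Fin 3) k) :
    dehomogenize k (Ideal.Quotient.mk _ p) = eval₂ AffineCurveRing.of
      ![AffineCurveRing.x k, AffineCurveRing.y k, 1] p := by
  simp [dehomogenize]

/-- The coordinate `z`. -/
def zCoord : CoordRing k := Ideal.Quotient.mk _ (X 2)

lemma zCoord_mem : zCoord k ∈ grading k 1 := mk_mem_grading k (isHomogeneous_X k 2)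

lemma dehomogenize_zCoord : dehomogenize k (zCoord k) = 1 := by
  simp [dehomogenize_mk, zCoord]

variable {k}

/-- The map from the coordinate ring of the chart `w ≠ 0` to the affine coordinate ring, where
`w` dehomogenizes to one. -/
def awayTo (w : CoordRing k) (hw : dehomogenize k w = 1) :
    HomogeneousLocalization.Away (grading k) w →+* AffineCurveRing k :=
  (IsLocalization.Away.lift (S := Localization.Away w) w
    (g := dehomogenize k) (by rw [hw]; exact isUnit_one)).comp
    (algebraMap (HomogeneousLocalization.Away (grading k) w) (Localization.Away w))

lemma awayTo_apply_of_val_eq (w : CoordRing k) (hw : dehomogenize k w = 1)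
    (t : HomogeneousLocalization.Away (grading k) w) (a : CoordRing k) (n : ℕ)
    (h : t.val * algebraMap _ (Localization.Away w) (w ^ n) = algebraMap _ _ a) :
    awayTo w hw t = dehomogenize k a := by
  have h2 := congrArg (IsLocalization.Away.lift (S := Localization.Away w) w
    (g := dehomogenize k) (by rw [hw]; exact isUnit_one)) h
  have hwn : dehomogenize k (w ^ n) = 1 := by rw [map_pow, hw, one_pow]
  rw [map_mul, IsLocalization.Away.lift_eq, IsLocalization.Away.lift_eq, hwn, mul_one] at h2
  rw [awayTo, RingHom.comp_apply, HomogeneousLocalization.algebraMap_apply, h2]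

lemma awayTo_mk (w : CoordRing k) (hw : dehomogenize k w = 1) {d : ℕ} (hd : w ∈ grading k d) (n : ℕ)
    (a : CoordRing k) (ha) :
    awayTo w hw (HomogeneousLocalization.Away.mk (grading k) hd n a ha) = dehomogenize k a := by
  refine awayTo_apply_of_val_eq w hw _ a n ?_
  rw [HomogeneousLocalization.Away.val_mk, Localization.mk_eq_mk']
  exact IsLocalization.mk'_spec (Localization.Away w) a (⟨w ^ n, n, rfl⟩ : Submonoid.powers w)

lemma val_fromZeroRingHom (w : CoordRing k) (c : k) :
    (HomogeneousLocalization.fromZeroRingHom (grading k) (Submonoid.powers w)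
      (algebraMap k (grading k 0) c)).val =
      algebraMap (CoordRing k) (Localization.Away w) (algebraMap k (CoordRing k) c) :=
  (HomogeneousLocalization.val_mk _).trans (Localization.mk_one_eq_algebraMap _)

lemma awayTo_fromZero (w : CoordRing k) (hw : dehomogenize k w = 1) (c : k) :
    awayTo w hw (HomogeneousLocalization.fromZeroRingHom (grading k) _
      (algebraMap k (grading k 0) c)) = AffineCurveRing.of c := by
  rw [awayTo_apply_of_val_eq w hw _ (algebraMap k (CoordRing k) c) 0
    (by rw [val_fromZeroRingHom, pow_zero, map_one, mul_one])]
  exact (dehomogenize_mk k (C c)).trans (by simp)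

variable (k) in
/-- The element `1 / z` of the localization at `z`. -/
def zInv : Localization.Away (zCoord k) := IsLocalization.Away.invSelf (zCoord k)

lemma zCoord_mul_zInv : algebraMap (CoordRing k) (Localization.Away (zCoord k)) (zCoord k) *
    zInv k = 1 :=
  IsLocalization.Away.mul_invSelf _

lemma val_mk_zCoord (n : ℕ) (a : CoordRing k) (ha) :
    (HomogeneousLocalization.Away.mk (grading k) (zCoord_mem k) n a ha).val =
      zInv k ^ n * algebraMap (CoordRing k) (Localization.Away (zCoord k)) a := by
  rw [HomogeneousLocalization.Away.val_mk, Localization.mk_eq_mk', IsLocalization.mk'_eq_iff_eq_mul,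
    map_pow]
  have h := congrArg (fun t => t ^ n) (zCoord_mul_zInv (k := k))
  simp only [mul_pow, one_pow] at h
  linear_combination -algebraMap (CoordRing k) (Localization.Away (zCoord k)) a * h

lemma coordRing_relation :
    (Ideal.Quotient.mk (Ideal.span {cubic k}) (X 1)) ^ 2 * zCoord k =
      Ideal.Quotient.mk _ (X 0) * (Ideal.Quotient.mk _ (X 0) ^ 2 - zCoord k ^ 2) := by
  have h : Ideal.Quotient.mk (Ideal.span {cubic k}) (cubic k) = 0 :=
    Ideal.Quotient.eq_zero_iff_mem.mpr (Ideal.mem_span_singleton_self _)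
  rw [cubic, map_sub, map_mul, map_mul, map_sub, map_pow, map_pow, map_pow, sub_eq_zero] at h
  exact h

/-- The map from the affine coordinate ring to the coordinate ring of the chart `z ≠ 0`. -/
def toAway : AffineCurveRing k →+* HomogeneousLocalization.Away (grading k) (zCoord k) :=
  AffineCurveRing.lift ((HomogeneousLocalization.fromZeroRingHom (grading k) _).comp
      (algebraMap k (grading k 0)))
    (HomogeneousLocalization.Away.mk (grading k) (zCoord_mem k) 1 (Ideal.Quotient.mk _ (X 0))
      (mk_mem_grading k (isHomogeneous_X k 0)))
    (HomogeneousLocalization.Away.mk (grading k) (zCoord_mem k) 1 (Ideal.Quotient.mk _ (X 1))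
      (mk_mem_grading k (isHomogeneous_X k 1))) (by
    apply HomogeneousLocalization.val_injective
    rw [HomogeneousLocalization.val_sub, HomogeneousLocalization.val_pow,
      HomogeneousLocalization.val_pow, val_mk_zCoord, val_mk_zCoord, pow_one]
    have h := congrArg (algebraMap (CoordRing k) (Localization.Away (zCoord k)))
      (coordRing_relation (k := k))
    simp only [map_mul, map_sub, map_pow] at h
    have h1 := zCoord_mul_zInv (k := k)
    set s := zInv k
    set Z := algebraMap (CoordRing k) (Localization.Away (zCoord k)) (zCoord k)
    set A := algebraMap (CoordRing k) (Localization.Away (zCoord k))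
      (Ideal.Quotient.mk (Ideal.span {cubic k}) (X 0))
    set B := algebraMap (CoordRing k) (Localization.Away (zCoord k))
      (Ideal.Quotient.mk (Ideal.span {cubic k}) (X 1))
    -- The cubic relation is divided by `z³`; the other term cancels the remaining factors `z ·
    -- (1/z)`.
    linear_combination s ^ 3 * h - (B ^ 2 * s ^ 2 + A * s * (1 + Z * s)) * h1)

/-- Dehomogenizing and returning to the chart is the ring homomorphism that scales every variable by
`1/z`; on forms of degree `n` this scaling is multiplication by `z⁻ⁿ`. -/
lemma val_toAway (p : MvPolynomial (Fin 3) k) {n : ℕ} (hp : p.IsHomogeneous n) :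
    (toAway (dehomogenize k (Ideal.Quotient.mk _ p))).val = zInv k ^ n *
      algebraMap (CoordRing k) (Localization.Away (zCoord k)) (Ideal.Quotient.mk _ p) := by
  let θ : MvPolynomial (Fin 3) k →+* Localization.Away (zCoord k) :=
    (algebraMap (CoordRing k) _).comp (Ideal.Quotient.mk (Ideal.span {cubic k}))
  let θ' : MvPolynomial (Fin 3) k →+* Localization.Away (zCoord k) :=
    (((algebraMap (HomogeneousLocalization.Away (grading k) (zCoord k)) _).comp toAway).comp
      (dehomogenize k)).comp (Ideal.Quotient.mk (Ideal.span {cubic k}))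
  have h1 : θ = eval₂Hom (θ.comp C) fun j => θ (X j) :=
    MvPolynomial.ringHom_ext (by simp) (by simp)
  have h2 : θ' = eval₂Hom (θ.comp C) fun j => zInv k * θ (X j) := by
    refine MvPolynomial.ringHom_ext (fun c => ?_) fun j => ?_
    · simp only [θ', θ, RingHom.comp_apply, coe_eval₂Hom, eval₂_C, dehomogenize_mk, toAway,
        AffineCurveRing.lift_of, HomogeneousLocalization.algebraMap_apply]
      exact val_fromZeroRingHom _ c
    · simp only [θ', RingHom.comp_apply, coe_eval₂Hom, eval₂_X, dehomogenize_mk,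
        HomogeneousLocalization.algebraMap_apply]
      fin_cases j
      · change (toAway (AffineCurveRing.x k)).val = _
        rw [toAway, AffineCurveRing.lift_x, val_mk_zCoord, pow_one]
        rfl
      · change (toAway (AffineCurveRing.y k)).val = _
        rw [toAway, AffineCurveRing.lift_y, val_mk_zCoord, pow_one]
        rfl
      · change (toAway 1).val = _
        rw [map_one, HomogeneousLocalization.val_one, mul_comm]
        exact zCoord_mul_zInv.symm
  have h3 := DFunLike.congr_fun h2 p
  rw [coe_eval₂Hom, eval₂_mul_of_isHomogeneous _ _ _ hp, ← coe_eval₂Hom, ← h1] at h3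
  rw [← HomogeneousLocalization.algebraMap_apply]
  exact h3

lemma toAway_comp_awayTo :
    toAway.comp (awayTo (zCoord k) (dehomogenize_zCoord k)) = RingHom.id _ := by
  ext t
  obtain ⟨n, a, ha, rfl⟩ := HomogeneousLocalization.Away.mk_surjective (grading k) (zCoord_mem k) t
  rw [RingHom.comp_apply, awayTo_mk, RingHom.id_apply, val_mk_zCoord]
  obtain ⟨p, hp, rfl⟩ := ha
  exact val_toAway p (by simpa using! hp)

lemma awayTo_comp_toAway :
    (awayTo (zCoord k) (dehomogenize_zCoord k)).comp toAway = RingHom.id _ := by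
  refine AffineCurveRing.hom_ext (fun r => ?_) ?_ ?_
  · simp [toAway, awayTo_fromZero]
  · simp [toAway, awayTo_mk, dehomogenize_mk]
  · simp [toAway, awayTo_mk, dehomogenize_mk]

end Chart

/-! ### Irreducibility of the curve, and its automorphism on the chart. -/

section CurveScheme

attribute [local instance] MvPolynomial.gradedAlgebra

variable (k : Type u) [Field k]

lemma finSuccEquiv_cubic : finSuccEquiv k 2 (-cubic k) =
    Polynomial.X ^ 3 - Polynomial.C (X 1 ^ 2) * Polynomial.X - Polynomial.C (X 0 ^ 2 * X 1) := by
  have h1 : finSuccEquiv k 2 (X 1) = Polynomial.C (X 0) := finSuccEquiv_X_succ (j := 0)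
  have h2 : finSuccEquiv k 2 (X 2) = Polynomial.C (X 1) := finSuccEquiv_X_succ (j := 1)
  simp only [cubic, map_neg, map_sub, map_mul, map_pow, finSuccEquiv_X_zero, h1, h2]
  ring

/-- Up to sign the cubic is `x³ - z² x - y² z`, monic in `x` and Eisenstein at `z`. -/
lemma prime_cubic : Prime (cubic k) := by
  rw [← (Associated.neg_left (Associated.refl (cubic k))).prime_iff,
    ← MulEquiv.prime_iff (finSuccEquiv k 2), finSuccEquiv_cubic, ← irreducible_iff_prime]
  set f : Polynomial (MvPolynomial (Fin 2) k) :=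
    Polynomial.X ^ 3 - Polynomial.C (X 1 ^ 2) * Polynomial.X - Polynomial.C (X 0 ^ 2 * X 1)
  have hdeg : f.natDegree = 3 := by simp only [f]; compute_degree!
  have hmonic : f.Monic := by
    rw [Polynomial.Monic, Polynomial.leadingCoeff, hdeg]
    simp [f, -map_pow, -map_mul]
  have hX : Prime (X 1 : MvPolynomial (Fin 2) k) := X_prime
  have hp : (Ideal.span {(X 1 : MvPolynomial (Fin 2) k)}).IsPrime :=
    (Ideal.span_singleton_prime hX.ne_zero).mpr hX
  refine Polynomial.IsEisensteinAt.irreducible (𝓟 := Ideal.span {X 1}) ⟨?_, ?_, ?_⟩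
    hp hmonic.isPrimitive (by rw [hdeg]; norm_num)
  · rw [hmonic.leadingCoeff]
    exact hp.one_notMem
  · intro n hn
    rw [hdeg] at hn
    rw [Ideal.mem_span_singleton]
    interval_cases n
    · simp [f, Polynomial.coeff_C, Polynomial.coeff_X_pow]
    · simp only [f, Polynomial.coeff_sub, Polynomial.coeff_X_pow, Polynomial.coeff_C_mul,
        Polynomial.coeff_X_one, Polynomial.coeff_C]
      simp [sq]
    · simp [f, -map_pow, -map_mul]
  · rw [Ideal.span_singleton_pow, Ideal.mem_span_singleton]
    simp only [f, Polynomial.coeff_sub, Polynomial.coeff_C_mul, Polynomial.coeff_X_pow,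
      Polynomial.coeff_C, Polynomial.coeff_X_zero]
    simp only [OfNat.zero_ne_ofNat, ↓reduceIte, mul_zero, zero_sub, sub_zero, dvd_neg]
    rw [sq, mul_dvd_mul_iff_right hX.ne_zero]
    rintro ⟨q, h⟩
    have := congrArg (eval ![1, 0]) h
    simp at this

instance : IsDomain (CoordRing k) := by
  have := (Ideal.span_singleton_prime (prime_cubic k).ne_zero).mpr (prime_cubic k)
  exact Ideal.Quotient.isDomain _

lemma zCoord_ne_zero : zCoord k ≠ 0 := fun h => by
  have := dehomogenize_zCoord k
  rw [h, map_zero] at this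
  exact zero_ne_one this

/-- The zero ideal is a point, because `z` is a nonzero element of the irrelevant ideal, and this
point lies in every nonempty basic open. -/
instance : IrreducibleSpace (curve k) := by
  let η : ProjectiveSpectrum (grading k) :=
    { asHomogeneousIdeal := ⊥
      isPrime := Ideal.isPrime_bot
      not_irrelevant_le := fun h => zCoord_ne_zero k
        (h (HomogeneousIdeal.mem_irrelevant_of_mem (grading k) one_pos (zCoord_mem k))) }
  have h : Dense ({η} : Set (ProjectiveSpectrum (grading k))) := by
    rw [(ProjectiveSpectrum.isTopologicalBasis_basic_opens (grading k)).dense_iff]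
    rintro _ ⟨f, rfl⟩ ⟨p, hp⟩
    refine ⟨η, fun hf => hp ?_, rfl⟩
    have : f = 0 := hf
    rw [this]
    exact zero_mem _
  have h2 := (isIrreducible_singleton (x := η)).closure
  rw [h.closure_eq] at h2
  have : IrreducibleSpace (ProjectiveSpectrum (grading k)) :=
    { isPreirreducible_univ := h2.2, toNonempty := ⟨η⟩ }
  exact this

instance : IsIso (CommRingCat.ofHom (awayTo (zCoord k) (dehomogenize_zCoord k))) :=
  ⟨CommRingCat.ofHom toAway, by
    rw [← CommRingCat.ofHom_comp, toAway_comp_awayTo]; rfl, by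
    rw [← CommRingCat.ofHom_comp, awayTo_comp_toAway]; rfl⟩

/-- The affine chart `z ≠ 0` of the curve. -/
def curveChart : Spec (.of (AffineCurveRing k)) ⟶ curve k :=
  Spec.map (CommRingCat.ofHom (awayTo (zCoord k) (dehomogenize_zCoord k))) ≫
    Proj.awayι (grading k) (zCoord k) (zCoord_mem k) one_pos

instance : IsOpenImmersion (curveChart k) := by
  unfold curveChart
  infer_instance

lemma curveChart_toSpec : curveChart k ≫ curveToSpec k =
    Spec.map (CommRingCat.ofHom AffineCurveRing.of) := by
  rw [curveChart, curveToSpec, Category.assoc, Proj.awayι_toSpecZero_assoc, ← Spec.map_comp,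
    ← Spec.map_comp, ← CommRingCat.ofHom_comp, ← CommRingCat.ofHom_comp]
  congr 2
  ext c
  exact awayTo_fromZero _ (dehomogenize_zCoord k) c

variable {k} (i : k) (hi : IsPrimitiveRoot i 4)

lemma gradedHom_mk (p : MvPolynomial (Fin 3) k) :
    gradedHom i hi (Ideal.Quotient.mk _ p) = Ideal.Quotient.mk _ (subst i p) := rfl

lemma gradedHom_zCoord : gradedHom i hi (zCoord k) = zCoord k := by
  rw [zCoord, gradedHom_mk]
  simp [subst]

lemma dehomogenize_gradedHom (t : CoordRing k) : dehomogenize k (gradedHom i hi t) =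
    AffineCurveRing.twist (RingHom.id k) i (sq_eq_neg_one hi) (dehomogenize k t) := by
  obtain ⟨p, rfl⟩ := Ideal.Quotient.mk_surjective t
  let θ : MvPolynomial (Fin 3) k →+* AffineCurveRing k :=
    ((dehomogenize k).comp (Ideal.Quotient.mk _)).comp (subst i).toRingHom
  let θ' : MvPolynomial (Fin 3) k →+* AffineCurveRing k :=
    (AffineCurveRing.twist (RingHom.id k) i (sq_eq_neg_one hi)).comp
      ((dehomogenize k).comp (Ideal.Quotient.mk _))
  have : θ = θ' := by
    refine MvPolynomial.ringHom_ext (fun c => ?_) fun j => ?_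
    · simp [θ, θ', dehomogenize_mk, AffineCurveRing.twist]
    · fin_cases j <;>
      simp [θ, θ', dehomogenize_mk, AffineCurveRing.twist, subst]
  exact DFunLike.congr_fun this p

/-- Functoriality of `Proj` produces the chart at `gradedHom i hi (zCoord k)`, equal to `zCoord k`
only propositionally; a free `w` allows the substitution. -/
lemma SpecMap_awayTo_awayι {w : CoordRing k} (hw : w = zCoord k) (hd : dehomogenize k w = 1)
    (hm : w ∈ grading k 1) : Spec.map (CommRingCat.ofHom (awayTo w hd)) ≫
      Proj.awayι (grading k) w hm one_pos = curveChart k := by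
  subst hw
  rfl

lemma curveChart_curveAut : curveChart k ≫ curveAut i hi =
    Spec.map (CommRingCat.ofHom
      (AffineCurveRing.twist (RingHom.id k) i (sq_eq_neg_one hi))) ≫ curveChart k := by
  have hz := gradedHom_zCoord i hi
  have hd : dehomogenize k (gradedHom i hi (zCoord k)) = 1 := by rw [hz, dehomogenize_zCoord]
  rw [← SpecMap_awayTo_awayι hz hd ((gradedHom i hi).2 (zCoord_mem k)), Category.assoc,
    curveAut, Proj.awayι_comp_map _ _ one_pos _ (zCoord_mem k), SpecMap_awayTo_awayι hz hd,
    curveChart, ← Spec.map_comp_assoc, ← Spec.map_comp_assoc, ← CommRingCat.ofHom_comp,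
    ← CommRingCat.ofHom_comp]
  congr 3
  ext t
  obtain ⟨n, a, ha, rfl⟩ := HomogeneousLocalization.Away.mk_surjective (grading k) (zCoord_mem k) t
  rw [RingHom.comp_apply, RingHom.comp_apply, HomogeneousLocalization.Away.map_mk,
    awayTo_mk, awayTo_mk, dehomogenize_gradedHom]

lemma subst_pow_four {i : k} (hi : IsPrimitiveRoot i 4) (p : MvPolynomial (Fin 3) k) :
    subst i (subst i (subst i (subst i p))) = p := by
  have h : i * (i * (i * i)) = 1 := by
    rw [← sq, sq_eq_neg_one hi, mul_neg_one, mul_neg, ← sq, sq_eq_neg_one hi, neg_neg]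
  have : ((subst i).comp (subst i)).comp ((subst i).comp (subst i)) = AlgHom.id k _ := by
    refine MvPolynomial.algHom_ext fun j => ?_
    fin_cases j
    · simp [subst]
    · have h2 := congrArg (C (σ := Fin 3)) h
      simp only [map_mul, map_one] at h2
      simp only [subst, AlgHom.comp_apply, aeval_X, map_mul, algHom_C, Matrix.cons_val,
        Fin.mk_one, algebraMap_eq, AlgHom.id_apply]
      linear_combination X 1 * h2
    · simp [subst]
  exact DFunLike.congr_fun this p

lemma projMap_eq_id {f : grading k →+*ᵍ grading k} (hf)
    (h : f = GradedRingHom.id (grading k)) : Proj.map f hf = 𝟙 (curve k) := by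
  subst h
  exact Proj.map_id

lemma curveAut_pow_four :
    curveAut i hi ≫ curveAut i hi ≫ curveAut i hi ≫ curveAut i hi = 𝟙 (curve k) := by
  rw [curveAut, ← Proj.map_comp, ← Proj.map_comp, ← Proj.map_comp]
  refine projMap_eq_id _ (GradedRingHom.ext fun t => ?_)
  obtain ⟨p, rfl⟩ := Ideal.Quotient.mk_surjective t
  exact congrArg (Ideal.Quotient.mk _) (subst_pow_four hi p)

end CurveScheme

/-! ### Charts of products with the curve. -/

section ProductChart

lemma pullbackMap_pow_four {X Y S : Scheme.{u}} (f : X ⟶ S) (g : Y ⟶ S) (a : X ⟶ X) (b : Y ⟶ Y)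
    (ha : a ≫ f = f) (hb : b ≫ g = g) (ha4 : a ≫ a ≫ a ≫ a = 𝟙 X) (hb4 : b ≫ b ≫ b ≫ b = 𝟙 Y) :
    let m := pullback.map f g f g a b (𝟙 S) (by rw [ha, Category.comp_id])
      (by rw [hb, Category.comp_id])
    m ≫ m ≫ m ≫ m = 𝟙 (pullback f g) := by
  intro m
  have h1 : m ≫ pullback.fst f g = pullback.fst f g ≫ a := pullback.lift_fst _ _ _
  have h2 : m ≫ pullback.snd f g = pullback.snd f g ≫ b := pullback.lift_snd _ _ _
  apply pullback.hom_ext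
  · simp only [Category.assoc, h1, reassoc_of% h1, ha4, Category.comp_id, Category.id_comp]
  · simp only [Category.assoc, h2, reassoc_of% h2, hb4, Category.comp_id, Category.id_comp]

variable {k : Type u} [Field k] {D : Type u} [CommRing D] {X : Scheme.{u}}

/-- The affine chart of the product of `X` with the curve over an affine chart of `X`. -/
def productChart (sX : X ⟶ Spec (.of k)) (c : k →+* D) (v : Spec (.of D) ⟶ X)
    (hv : v ≫ sX = Spec.map (CommRingCat.ofHom c)) :
    Spec (.of (AffineCurveRing D)) ⟶ pullback sX (curveToSpec k) :=
  pullback.lift (Spec.map (CommRingCat.ofHom AffineCurveRing.of) ≫ v)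
    (Spec.map (CommRingCat.ofHom (AffineCurveRing.map c)) ≫ curveChart k) (by
    rw [Category.assoc, Category.assoc, hv, curveChart_toSpec, ← Spec.map_comp, ← Spec.map_comp,
      (AffineCurveRing.isPushout c).w])

variable (sX : X ⟶ Spec (.of k)) (c : k →+* D) (v : Spec (.of D) ⟶ X)
  (hv : v ≫ sX = Spec.map (CommRingCat.ofHom c))

lemma productChart_fst : productChart sX c v hv ≫ pullback.fst _ _ =
    Spec.map (CommRingCat.ofHom AffineCurveRing.of) ≫ v := pullback.lift_fst _ _ _

lemma productChart_snd : productChart sX c v hv ≫ pullback.snd _ _ =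
    Spec.map (CommRingCat.ofHom (AffineCurveRing.map c)) ≫ curveChart k := pullback.lift_snd _ _ _

lemma productChart_toSpec : productChart sX c v hv ≫ pullback.fst _ _ ≫ sX =
    Spec.map (CommRingCat.ofHom (AffineCurveRing.of.comp c)) := by
  rw [← Category.assoc, productChart_fst, Category.assoc, hv, ← Spec.map_comp]
  rfl

lemma productChart_eq : productChart sX c v hv =
    (isPullback_SpecMap_of_isPushout _ _ _ _ (AffineCurveRing.isPushout c)).isoPullback.hom ≫
      pullback.map _ _ sX (curveToSpec k) v (curveChart k) (𝟙 _)
        (by rw [Category.comp_id, hv]) (by rw [Category.comp_id, curveChart_toSpec]) := by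
  apply pullback.hom_ext
  · rw [productChart_fst, Category.assoc, pullback.map, pullback.lift_fst,
      IsPullback.isoPullback_hom_fst_assoc]
  · rw [productChart_snd, Category.assoc, pullback.map, pullback.lift_snd,
      IsPullback.isoPullback_hom_snd_assoc]

instance [IsOpenImmersion v] : IsOpenImmersion (productChart sX c v hv) := by
  rw [productChart_eq]
  infer_instance

/-- The range is the intersection of the preimages of two nonempty opens under the projections. Both
projections are flat, being base changes of morphisms to the spectrum of a field, and both factors
are irreducible. -/
lemma isDominant_productChart [IrreducibleSpace X] [IsOpenImmersion v] [Nontrivial D] :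
    IsDominant (productChart sX c v hv) := by
  constructor
  rw [DenseRange, productChart_eq]
  rw [Scheme.Hom.comp_base, TopCat.coe_comp, Set.range_comp, Set.range_eq_univ.mpr (by exact
    (isPullback_SpecMap_of_isPushout _ _ _ _
      (AffineCurveRing.isPushout c)).isoPullback.hom.homeomorph.surjective), Set.image_univ,
    Scheme.Pullback.range_map]
  have h1 : (Set.range v).Nonempty := Set.range_nonempty _
  have h2 : (Set.range (curveChart k)).Nonempty := Set.range_nonempty _
  have hv := v.isOpenEmbedding.isOpen_range
  exact (dense_preimage_of_flat (pullback.fst sX (curveToSpec k)) hv h1).inter_of_isOpen_left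
    (dense_preimage_of_flat (pullback.snd sX (curveToSpec k))
      (curveChart k).isOpenEmbedding.isOpen_range h2)
    (hv.preimage (pullback.fst sX (curveToSpec k)).continuous)

lemma productChart_map (i : k) (hi : IsPrimitiveRoot i 4) (a : X ⟶ X) (ha : a ≫ sX = sX)
    (γ : D →+* D) (hγ : γ.comp c = c) (hva : v ≫ a = Spec.map (CommRingCat.ofHom γ) ≫ v)
    (he : (c i) ^ 2 = -1) :
    productChart sX c v hv ≫ pullback.map _ _ _ _ a (curveAut i hi) (𝟙 _)
      (by rw [ha, Category.comp_id]) (by rw [curveAut_toSpec, Category.comp_id]) =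
    Spec.map (CommRingCat.ofHom (AffineCurveRing.twist γ (c i) he)) ≫ productChart sX c v hv := by
  apply pullback.hom_ext
  · rw [Category.assoc, pullback.map, pullback.lift_fst, ← Category.assoc, productChart_fst,
      Category.assoc, hva, Category.assoc, productChart_fst, ← Spec.map_comp_assoc,
      ← Spec.map_comp_assoc, ← CommRingCat.ofHom_comp, ← CommRingCat.ofHom_comp]
    refine congrArg (fun t => Spec.map (CommRingCat.ofHom t) ≫ v) (RingHom.ext fun r => ?_)
    rw [RingHom.comp_apply, RingHom.comp_apply, AffineCurveRing.twist, AffineCurveRing.lift_of,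
      RingHom.comp_apply]
  · rw [Category.assoc, pullback.map, pullback.lift_snd, ← Category.assoc, productChart_snd,
      Category.assoc, curveChart_curveAut, Category.assoc, productChart_snd, ← Spec.map_comp_assoc,
      ← Spec.map_comp_assoc, ← CommRingCat.ofHom_comp, ← CommRingCat.ofHom_comp]
    refine congrArg (fun t => Spec.map (CommRingCat.ofHom t) ≫ curveChart k)
      (AffineCurveRing.hom_ext (fun r => ?_) ?_ ?_)
    · simpa [AffineCurveRing.twist, AffineCurveRing.map] using
        congrArg AffineCurveRing.of (DFunLike.congr_fun hγ r).symm
    · simp [AffineCurveRing.twist, AffineCurveRing.map]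
    · simp [AffineCurveRing.twist, AffineCurveRing.map]

end ProductChart

/-! ### The chart of `C × C × C` and the diagonal automorphism on it. -/

section Triple

variable (k : Type u) [Field k]

/-- The coordinate ring of the affine chart of `C × C × C`. -/
abbrev TripleRing : Type u := AffineCurveRing (AffineCurveRing (AffineCurveRing k))

/-- The inclusion of the constants in the coordinate ring of the chart of `C × C × C`. -/
def tripleOf : k →+* TripleRing k :=
  AffineCurveRing.of.comp (AffineCurveRing.of.comp AffineCurveRing.of)

/-- The affine chart of `C × C`. -/
def surfaceChart : Spec (.of (AffineCurveRing (AffineCurveRing k))) ⟶ surface k :=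
  productChart (curveToSpec k) AffineCurveRing.of (curveChart k) (curveChart_toSpec k)

lemma surfaceChart_toSpec : surfaceChart k ≫ surfaceToSpec k =
    Spec.map (CommRingCat.ofHom (AffineCurveRing.of.comp AffineCurveRing.of)) :=
  productChart_toSpec _ _ _ _

instance : IsOpenImmersion (surfaceChart k) := by
  unfold surfaceChart
  infer_instance

/-- The coordinate ring of a Weierstrass curve over a domain is a domain, so the dense affine chart
is irreducible over any `k`. -/
instance : IrreducibleSpace (surface k) := by
  have : IsDominant (surfaceChart k) := isDominant_productChart _ _ _ _
  exact irreducibleSpace_of_isDominant (surfaceChart k)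

/-- The affine chart of `C × C × C`. -/
def tripleChart : Spec (.of (TripleRing k)) ⟶ triple k :=
  productChart (surfaceToSpec k) (AffineCurveRing.of.comp AffineCurveRing.of) (surfaceChart k)
    (surfaceChart_toSpec k)

lemma tripleChart_toSpec : tripleChart k ≫ tripleToSpec k =
    Spec.map (CommRingCat.ofHom (tripleOf k)) :=
  productChart_toSpec _ _ _ _

instance : IsOpenImmersion (tripleChart k) := by
  unfold tripleChart
  infer_instance

instance : IrreducibleSpace (triple k) := by
  have : IsDominant (tripleChart k) := isDominant_productChart _ _ _ _
  exact irreducibleSpace_of_isDominant (tripleChart k)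

variable {k} {i : k} (hi : IsPrimitiveRoot i 4)

/-- The automorphism of the coordinate ring of the chart of `C × C`. -/
def surfaceTwist : AffineCurveRing (AffineCurveRing k) →+* AffineCurveRing (AffineCurveRing k) :=
  AffineCurveRing.twist (AffineCurveRing.twist (RingHom.id k) i (sq_eq_neg_one hi))
    (AffineCurveRing.of i) (by rw [← map_pow, sq_eq_neg_one hi, map_neg, map_one])

/-- The automorphism of the coordinate ring of the chart of `C × C × C`. -/
def tripleTwist : TripleRing k →+* TripleRing k :=
  AffineCurveRing.twist (surfaceTwist hi) (AffineCurveRing.of (AffineCurveRing.of i))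
    (by rw [← map_pow, ← map_pow, sq_eq_neg_one hi, map_neg, map_neg, map_one, map_one])

lemma surfaceChart_surfaceAut : surfaceChart k ≫ surfaceAut i hi =
    Spec.map (CommRingCat.ofHom (surfaceTwist hi)) ≫ surfaceChart k :=
  productChart_map _ _ _ _ i hi _ (curveAut_toSpec i hi) _
    (by ext r; simp [AffineCurveRing.twist]) (curveChart_curveAut i hi) _

lemma tripleChart_tripleAut : tripleChart k ≫ tripleAut i hi =
    Spec.map (CommRingCat.ofHom (tripleTwist hi)) ≫ tripleChart k :=
  productChart_map _ _ _ _ i hi _ (surfaceAut_toSpec i hi) _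
    (by ext r; simp [surfaceTwist, AffineCurveRing.twist]) (surfaceChart_surfaceAut hi) _

lemma tripleAut_pow_four :
    tripleAut i hi ≫ tripleAut i hi ≫ tripleAut i hi ≫ tripleAut i hi = 𝟙 (triple k) :=
  pullbackMap_pow_four _ _ _ _ (surfaceAut_toSpec i hi) (curveAut_toSpec i hi)
    (pullbackMap_pow_four _ _ _ _ (curveAut_toSpec i hi) (curveAut_toSpec i hi)
      (curveAut_pow_four i hi) (curveAut_pow_four i hi)) (curveAut_pow_four i hi)

end Triple

/-! ### Smoothness of `H` where the derivative with respect to `a` is invertible. -/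

section Smoothness

variable (k : Type u) [Field k]

/-- The coordinate functions `a, b, α, β` on the hypersurface. -/
def coord (j : Fin 4) : HypersurfaceRing k := Ideal.Quotient.mk _ (X j)

/-- The derivative with respect to `a` of the equation of the hypersurface. -/
def hypersurfaceDeriv : HypersurfaceRing k :=
  2 * coord k 0 * (coord k 3 * (1 - coord k 3 ^ 2))

instance : Algebra.FinitePresentation k (HypersurfaceRing k) :=
  Algebra.FinitePresentation.quotient ⟨{hypersurfacePoly k}, by simp⟩

variable {k}

/-- Solutions of the equation of the hypersurface at which the derivative with respect to `a` is
invertible lift along square-zero ideals. -/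
lemma exists_hypersurfaceLift {C : Type*} [CommRing C] [Algebra k C] (I : Ideal C) (hI : I ^ 2 = ⊥)
    (w : HypersurfaceRing k →ₐ[k] C ⧸ I) (hw : IsUnit (w (hypersurfaceDeriv k))) :
    ∃ w' : HypersurfaceRing k →ₐ[k] C, (Ideal.Quotient.mkₐ k I).comp w' = w := by
  have hnil : ∀ t ∈ I, t ^ 2 = 0 := fun t ht => by
    rw [← Ideal.mem_bot, ← hI]
    exact Ideal.pow_mem_pow ht 2
  choose v hv using fun j => Ideal.Quotient.mk_surjective (w (coord k j))
  have hunit : IsUnit (2 * v 0 * (v 3 * (1 - v 3 ^ 2))) := by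
    rw [← IsNilpotent.isUnit_quotient_mk_iff (I := I) ⟨2, hI⟩]
    simpa only [hypersurfaceDeriv, map_mul, map_ofNat, map_sub, map_one, map_pow, hv] using hw
  obtain ⟨s, hs⟩ := hunit.exists_right_inv
  set F := v 0 ^ 2 * v 3 * (1 - v 3 ^ 2) -
      (v 2 ^ 2 * v 1 * (1 - v 1 ^ 2) + v 1 * v 3 * (v 1 ^ 2 - v 3 ^ 2)) with hF
  have hFI : F ∈ I := by
    rw [← Ideal.Quotient.eq_zero_iff_mem, hF]
    simp only [map_mul, map_sub, map_one, map_pow, map_add, hv]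
    have h := congrArg w (hypersurfaceRing_relation (k := k))
    rw [map_zero] at h
    simpa only [coord, map_mul, map_sub, map_one, map_pow, map_add] using h
  have h2 : F ^ 2 = 0 := hnil F hFI
  -- A Newton step: `F` is the error of an arbitrary lift and `s` the inverse of the derivative, so
  -- replacing `a` by `a - F s` leaves only a multiple of `F² = 0`.
  let θ : HypersurfaceRing k →+* C :=
    hypersurfaceLift (algebraMap k C) ![v 0 - F * s, v 1, v 2, v 3] (by
      simp only [Matrix.cons_val]
      linear_combination (v 3 * (1 - v 3 ^ 2) * s ^ 2) * h2 - F * hs)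
  refine ⟨{ θ with commutes' := fun c => hypersurfaceLift_algebraMap _ _ _ c }, ?_⟩
  have h : (Ideal.Quotient.mk I).comp θ = w.toRingHom := by
    refine hypersurfaceRing_hom_ext (fun c => ?_) fun j => ?_
    · rw [RingHom.comp_apply]
      refine (congrArg (Ideal.Quotient.mk I) (hypersurfaceLift_algebraMap _ _ _ c)).trans ?_
      exact (w.commutes c).symm
    · rw [RingHom.comp_apply]
      refine (congrArg (Ideal.Quotient.mk I) (hypersurfaceLift_X _ _ _ j)).trans ?_
      refine Eq.trans ?_ (hv j)
      fin_cases j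
      · simp [Ideal.Quotient.eq_zero_iff_mem.mpr hFI]
      · rfl
      · rfl
      · rfl
  exact AlgHom.ext fun t => DFunLike.congr_fun h t

/-- The infinitesimal lifting found on the coordinate ring of `H` extends to the localization, since
an element that is a unit modulo a nilpotent ideal is a unit. -/
lemma smooth_of_isUnit_hypersurfaceDeriv {B : Type u} [CommRing B] [Algebra k B]
    [Algebra (HypersurfaceRing k) B] [IsScalarTower k (HypersurfaceRing k) B]
    (r : HypersurfaceRing k) [IsLocalization.Away r B]
    (h : IsUnit (algebraMap (HypersurfaceRing k) B (hypersurfaceDeriv k))) :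
    Algebra.Smooth k B := by
  have hfp : Algebra.FinitePresentation (HypersurfaceRing k) B :=
    IsLocalization.Away.finitePresentation r
  refine ⟨Algebra.FormallySmooth.of_comp_surjective fun C _ _ I hI w => ?_,
    Algebra.FinitePresentation.trans k (HypersurfaceRing k) B⟩
  obtain ⟨w', hw'⟩ := exists_hypersurfaceLift I hI
    (w.comp (IsScalarTower.toAlgHom k (HypersurfaceRing k) B)) (h.map w)
  have hr : IsUnit (w' r) := by
    rw [← IsNilpotent.isUnit_quotient_mk_iff (I := I) ⟨2, hI⟩]
    have : Ideal.Quotient.mk I (w' r) = w (algebraMap _ B r) := DFunLike.congr_fun hw' r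
    rw [this]
    exact (IsLocalization.Away.algebraMap_isUnit r).map w
  let θ : B →+* C := IsLocalization.Away.lift r (g := w'.toRingHom) hr
  have hθ (t) : θ (algebraMap _ B t) = w' t := IsLocalization.Away.lift_eq r hr t
  refine ⟨{ θ with commutes' := fun c => ?_ }, ?_⟩
  · have := hθ (algebraMap k _ c)
    rw [w'.commutes, ← IsScalarTower.algebraMap_apply] at this
    exact this
  · have : (Ideal.Quotient.mk I).comp θ = w.toRingHom := by
      refine IsLocalization.ringHom_ext (Submonoid.powers r) (RingHom.ext fun t => ?_)
      rw [RingHom.comp_apply, RingHom.comp_apply, hθ]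
      exact DFunLike.congr_fun hw' t
    exact AlgHom.ext fun t => DFunLike.congr_fun this t

end Smoothness

/-! ### Weights of monomials and averaging over the group. -/

section Invariants

namespace TripleRing

variable (k : Type u) [Field k]

/-- The coordinate `x` of the first factor. -/
def x₁ : TripleRing k := AffineCurveRing.of (AffineCurveRing.of (AffineCurveRing.x _))

/-- The coordinate `y` of the first factor. -/
def y₁ : TripleRing k := AffineCurveRing.of (AffineCurveRing.of (AffineCurveRing.y _))

/-- The coordinate `x` of the second factor. -/
def x₂ : TripleRing k := AffineCurveRing.of (AffineCurveRing.x _)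

/-- The coordinate `y` of the second factor. -/
def y₂ : TripleRing k := AffineCurveRing.of (AffineCurveRing.y _)

/-- The coordinate `x` of the third factor. -/
def x₃ : TripleRing k := AffineCurveRing.x _

/-- The coordinate `y` of the third factor. -/
def y₃ : TripleRing k := AffineCurveRing.y _

lemma relation₁ : y₁ k ^ 2 = x₁ k ^ 3 - x₁ k := by
  simp only [y₁, x₁, ← map_pow, ← map_sub, AffineCurveRing.relation]

lemma relation₂ : y₂ k ^ 2 = x₂ k ^ 3 - x₂ k := by
  simp only [y₂, x₂, ← map_pow, ← map_sub, AffineCurveRing.relation]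

lemma relation₃ : y₃ k ^ 2 = x₃ k ^ 3 - x₃ k := AffineCurveRing.relation _

variable {k}

/-- The product of a constant and a monomial in the coordinates. -/
def monomial (c : k) (m₁ e₁ m₂ e₂ m₃ e₃ : ℕ) : TripleRing k :=
  tripleOf k c * (x₁ k ^ m₁ * y₁ k ^ e₁) * (x₂ k ^ m₂ * y₂ k ^ e₂) * (x₃ k ^ m₃ * y₃ k ^ e₃)

lemma induction {p : TripleRing k → Prop} (hadd : ∀ a b, p a → p b → p (a + b))
    (h : ∀ c m₁ e₁ m₂ e₂ m₃ e₃, p (monomial c m₁ e₁ m₂ e₂ m₃ e₃)) (t : TripleRing k) : p t := by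
  have aux (D : Type u) [CommRing D] {q : AffineCurveRing D → Prop}
      (hadd : ∀ a b, q a → q b → q (a + b))
      (h : ∀ r (m e : ℕ), q (AffineCurveRing.of r *
        (AffineCurveRing.x D ^ m * AffineCurveRing.y D ^ e))) (t) : q t :=
    AffineCurveRing.induction hadd (fun r m => by simpa using h r m 0)
      (fun r m => by simpa [mul_assoc] using h r m 1) t
  refine aux _ hadd (fun r m₃ e₃ => ?_) t
  refine aux _ (q := fun r => p (AffineCurveRing.of r * _)) (fun a b ha hb => ?_)
    (fun r m₂ e₂ => ?_) r
  · rw [map_add, add_mul]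
    exact hadd _ _ ha hb
  refine aux _ (q := fun r => p (AffineCurveRing.of (AffineCurveRing.of r * _) * _))
    (fun a b ha hb => ?_) (fun r m₁ e₁ => ?_) r
  · rw [map_add, add_mul, map_add, add_mul]
    exact hadd _ _ ha hb
  have := h r m₁ e₁ m₂ e₂ m₃ e₃
  simpa only [monomial, tripleOf, x₁, y₁, x₂, y₂, x₃, y₃, map_mul, map_pow, RingHom.comp_apply]
    using this

section Twist

variable {i : k} (hi : IsPrimitiveRoot i 4)

lemma twist_of (c : k) : tripleTwist hi (tripleOf k c) = tripleOf k c := by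
  simp [tripleTwist, surfaceTwist, tripleOf, AffineCurveRing.twist]

lemma twist_x₁ : tripleTwist hi (x₁ k) = -x₁ k := by
  simp [tripleTwist, surfaceTwist, x₁, AffineCurveRing.twist]

lemma twist_x₂ : tripleTwist hi (x₂ k) = -x₂ k := by
  simp [tripleTwist, surfaceTwist, x₂, AffineCurveRing.twist]

lemma twist_x₃ : tripleTwist hi (x₃ k) = -x₃ k := by
  simp [tripleTwist, x₃, AffineCurveRing.twist]

lemma twist_y₁ : tripleTwist hi (y₁ k) = tripleOf k i * y₁ k := by
  simp [tripleTwist, surfaceTwist, y₁, AffineCurveRing.twist, tripleOf]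

lemma twist_y₂ : tripleTwist hi (y₂ k) = tripleOf k i * y₂ k := by
  simp [tripleTwist, surfaceTwist, y₂, AffineCurveRing.twist, tripleOf]

lemma twist_y₃ : tripleTwist hi (y₃ k) = tripleOf k i * y₃ k := by
  simp [tripleTwist, y₃, AffineCurveRing.twist, tripleOf]

lemma twist_monomial (c : k) (m₁ e₁ m₂ e₂ m₃ e₃ : ℕ) :
    tripleTwist hi (monomial c m₁ e₁ m₂ e₂ m₃ e₃) =
      tripleOf k (i ^ (2 * (m₁ + m₂ + m₃) + (e₁ + e₂ + e₃))) * monomial c m₁ e₁ m₂ e₂ m₃ e₃ := by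
  have hneg (t : TripleRing k) : -t = tripleOf k (i ^ 2) * t := by
    rw [sq_eq_neg_one hi, map_neg, map_one, neg_one_mul]
  simp only [monomial, map_mul, map_pow, twist_of, twist_x₁, twist_x₂, twist_x₃, twist_y₁, twist_y₂,
    twist_y₃]
  rw [hneg (x₁ k), hneg (x₂ k), hneg (x₃ k)]
  simp only [map_pow]
  ring

/-- The sum over the orbit of the automorphism. -/
def orbitSum (t : TripleRing k) : TripleRing k :=
  t + tripleTwist hi t + tripleTwist hi (tripleTwist hi t) +
    tripleTwist hi (tripleTwist hi (tripleTwist hi t))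

/-- Each `x_j` has weight 2 and each `y_j` weight 1, so the orbit sum multiplies the monomial by `1
+ ζ + ζ² + ζ³` with `ζ = iⁿ`. This is `4` if `ζ = 1`, and otherwise `0` because `ζ⁴ = 1`. -/
lemma orbitSum_monomial (c : k) (m₁ e₁ m₂ e₂ m₃ e₃ : ℕ) :
    orbitSum hi (monomial c m₁ e₁ m₂ e₂ m₃ e₃) = 0 ∨
      4 ∣ 2 * (m₁ + m₂ + m₃) + (e₁ + e₂ + e₃) ∧
      orbitSum hi (monomial c m₁ e₁ m₂ e₂ m₃ e₃) = monomial (4 * c) m₁ e₁ m₂ e₂ m₃ e₃ := by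
  set n := 2 * (m₁ + m₂ + m₃) + (e₁ + e₂ + e₃)
  have h : orbitSum hi (monomial c m₁ e₁ m₂ e₂ m₃ e₃) =
      tripleOf k (1 + i ^ n + (i ^ n) ^ 2 + (i ^ n) ^ 3) * monomial c m₁ e₁ m₂ e₂ m₃ e₃ := by
    simp only [orbitSum, twist_monomial, map_mul, map_add, map_one, map_pow, twist_of]
    ring
  rw [h]
  by_cases hn : i ^ n = 1
  · refine Or.inr ⟨(hi.pow_eq_one_iff_dvd n).mp hn, ?_⟩
    rw [hn]
    simp only [monomial, map_mul, map_add, map_one, map_pow, map_ofNat]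
    ring
  · left
    have h4 : (i ^ n - 1) * (1 + i ^ n + (i ^ n) ^ 2 + (i ^ n) ^ 3) = 0 := by
      have : (i ^ n) ^ 4 = 1 := by rw [← pow_mul, mul_comm, pow_mul, hi.pow_eq_one, one_pow]
      linear_combination this
    rw [(mul_eq_zero.mp h4).resolve_left (sub_ne_zero.mpr hn), map_zero, zero_mul]

end Twist

end TripleRing

end Invariants

/-! ### The invariant ratios as coordinates on `H`. -/

section QuotientCoords

namespace TripleRing

/-- With `a = Y'/Y` and `b = X'/X`, the two curve equations give `a² (X³ - X) = b³ X³ - b X`; divide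
by `X`. This expresses `X²` through the ratios. -/
lemma sq_mul_eq {T : Type*} [CommRing T] {X Y X' Y' p q : T} (hp : X * p = 1) (hq : Y * q = 1)
    (h : Y ^ 2 = X ^ 3 - X) (h' : Y' ^ 2 = X' ^ 3 - X') :
    X ^ 2 * ((Y' * q) ^ 2 - (X' * p) ^ 3) = (Y' * q) ^ 2 - X' * p := by
  have e : X ^ 2 - 1 = p * Y ^ 2 := by linear_combination (-p) * h - (X ^ 2 - 1) * hp
  linear_combination e * Y' ^ 2 * q ^ 2 + p * Y' ^ 2 * (Y * q + 1) * hq + p * h' -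
    p * X' ^ 3 * (X * p + 1) * hp

variable {k : Type u} [Field k] {T : Type u} [CommRing T]

lemma map_relation₁ (c : TripleRing k →+* T) : c (y₁ k) ^ 2 = c (x₁ k) ^ 3 - c (x₁ k) := by
  simp only [← map_pow, ← map_sub, relation₁]

lemma map_relation₂ (c : TripleRing k →+* T) : c (y₂ k) ^ 2 = c (x₂ k) ^ 3 - c (x₂ k) := by
  simp only [← map_pow, ← map_sub, relation₂]

lemma map_relation₃ (c : TripleRing k →+* T) : c (y₃ k) ^ 2 = c (x₃ k) ^ 3 - c (x₃ k) := by
  simp only [← map_pow, ← map_sub, relation₃]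

/-- The map `a = y₂ / y₁`, `b = x₂ / x₁`, `α = y₃ / y₁`, `β = x₃ / x₁` from the coordinate ring of
the hypersurface to a ring in which `x₁` and `y₁` have inverses `p` and `q`. -/
def quotientCoords (c : TripleRing k →+* T) (p q : T) (hp : c (x₁ k) * p = 1)
    (hq : c (y₁ k) * q = 1) : HypersurfaceRing k →+* T :=
  hypersurfaceLift (c.comp (tripleOf k))
    ![c (y₂ k) * q, c (x₂ k) * p, c (y₃ k) * q, c (x₃ k) * p] (by
    have h2 := sq_mul_eq hp hq (map_relation₁ c) (map_relation₂ c)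
    have h3 := sq_mul_eq hp hq (map_relation₁ c) (map_relation₃ c)
    simp only [Matrix.cons_val]
    set a := c (y₂ k) * q
    set b := c (x₂ k) * p
    set α := c (y₃ k) * q
    set β := c (x₃ k) * p
    -- Cross-multiplication eliminates `x₁²` from its two expressions.
    linear_combination (a ^ 2 - b ^ 3) * h3 - (α ^ 2 - β ^ 3) * h2)

section

variable (c : TripleRing k →+* T) (p q : T) (hp : c (x₁ k) * p = 1) (hq : c (y₁ k) * q = 1)

@[simp]
lemma quotientCoords_algebraMap (t : k) :
    quotientCoords c p q hp hq (algebraMap k _ t) = c (tripleOf k t) :=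
  hypersurfaceLift_algebraMap _ _ _ _

@[simp]
lemma quotientCoords_a : quotientCoords c p q hp hq (coord k 0) = c (y₂ k) * q :=
  hypersurfaceLift_X _ _ _ _

@[simp]
lemma quotientCoords_b : quotientCoords c p q hp hq (coord k 1) = c (x₂ k) * p :=
  hypersurfaceLift_X _ _ _ _

@[simp]
lemma quotientCoords_α : quotientCoords c p q hp hq (coord k 2) = c (y₃ k) * q :=
  hypersurfaceLift_X _ _ _ _

@[simp]
lemma quotientCoords_β : quotientCoords c p q hp hq (coord k 3) = c (x₃ k) * p :=
  hypersurfaceLift_X _ _ _ _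

lemma comp_quotientCoords {T' : Type u} [CommRing T'] (g : T →+* T') (c' : TripleRing k →+* T')
    (hc : ∀ t, g (c t) = c' t) (p' q' : T') (hp' : c' (x₁ k) * p' = 1) (hq' : c' (y₁ k) * q' = 1) :
    g.comp (quotientCoords c p q hp hq) = quotientCoords c' p' q' hp' hq' := by
  have h1 : g p = p' := by
    have := congrArg g hp
    rw [map_mul, map_one, hc] at this
    exact left_inv_eq_right_inv (by rw [mul_comm, this]) hp'
  have h2 : g q = q' := by
    have := congrArg g hq
    rw [map_mul, map_one, hc] at this
    exact left_inv_eq_right_inv (by rw [mul_comm, this]) hq'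
  refine hypersurfaceRing_hom_ext (fun t => ?_) fun j => ?_
  · simp [hc]
  · change g (quotientCoords c p q hp hq (coord k j)) = quotientCoords c' p' q' hp' hq' (coord k j)
    fin_cases j <;> simp [hc, h1, h2]

end

/-- The restriction of functions to the curve `a = α = 1`, `b = β`. -/
def diagonal : HypersurfaceRing k →+* Polynomial k :=
  hypersurfaceLift Polynomial.C ![1, Polynomial.X, 1, Polynomial.X] (by
    simp only [Matrix.cons_val]
    ring)

/-- On the curve `a = α = 1`, `b = β` inside `H` these functions become `1 - b³`, `1 - b` and `b³ -
b`. -/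
lemma coord_nonvanishing : coord k 0 ^ 2 - coord k 1 ^ 3 ≠ 0 ∧ coord k 0 ^ 2 - coord k 1 ≠ 0 ∧
    coord k 1 ^ 3 - coord k 1 ≠ 0 := by
  have h0 : diagonal (coord k 0) = 1 := hypersurfaceLift_X _ _ _ _
  have h1 : diagonal (coord k 1) = Polynomial.X := hypersurfaceLift_X _ _ _ _
  refine ⟨fun h => ?_, fun h => ?_, fun h => ?_⟩
  all_goals
    have h2 := congrArg diagonal h
    simp only [map_sub, map_pow, h0, h1, map_zero, one_pow] at h2
  · have := congrArg (fun p => p.coeff 0) h2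
    simp at this
  · have := congrArg (fun p => p.coeff 0) h2
    simp at this
  · have := congrArg (fun p => p.coeff 1) h2
    simp [Polynomial.coeff_X_pow] at this

/-- A point of the chart of `C × C × C`, with values in an algebraic closure of the function field
of the hypersurface, over the generic point of the hypersurface. -/
lemma exists_geometricPoint : ∃ (c : TripleRing k →+* AlgebraicClosure
      (FractionRing (HypersurfaceRing k))) (p q : _) (hp : c (x₁ k) * p = 1)
      (hq : c (y₁ k) * q = 1), Function.Injective (quotientCoords c p q hp hq) := by
  set K := AlgebraicClosure (FractionRing (HypersurfaceRing k))
  let e : HypersurfaceRing k →+* K :=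
    (algebraMap (FractionRing (HypersurfaceRing k)) K).comp (algebraMap _ _)
  have he : Function.Injective e :=
    (algebraMap (FractionRing (HypersurfaceRing k)) K).injective.comp (IsFractionRing.injective (HypersurfaceRing k) (FractionRing (HypersurfaceRing k)))
  have hne : ∀ t, t ≠ 0 → e t ≠ 0 := fun t ht h => ht (he (by rw [h, map_zero]))
  obtain ⟨hD, hN, hM⟩ := coord_nonvanishing (k := k)
  replace hD := hne _ hD
  replace hN := hne _ hN
  replace hM := hne _ hM
  have hrel : (e (coord k 0) ^ 2 - e (coord k 1)) * (e (coord k 2) ^ 2 - e (coord k 3) ^ 3) =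
      (e (coord k 2) ^ 2 - e (coord k 3)) * (e (coord k 0) ^ 2 - e (coord k 1) ^ 3) := by
    have := congrArg e (hypersurfaceRing_relation (k := k))
    simp only [map_sub, map_add, map_mul, map_pow, map_one, map_zero] at this
    simp only [coord]
    linear_combination this
  simp only [map_sub, map_pow] at hD hN hM
  set a := e (coord k 0)
  set b := e (coord k 1)
  set α := e (coord k 2)
  set β := e (coord k 3)
  -- `s` and `y` are the values of `x₁` and `y₁`. The three points of `C` will be `(s, y)`, `(b s, a
  -- y)`, `(β s, α y)`; the equation of `H` makes the same `s` serve for the third.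
  obtain ⟨s, hs⟩ := IsAlgClosed.exists_pow_nat_eq ((a ^ 2 - b) / (a ^ 2 - b ^ 3)) (n := 2) (by simp)
  obtain ⟨y, hy⟩ := IsAlgClosed.exists_pow_nat_eq (s ^ 3 - s) (n := 2) (by simp)
  have hs2 : s ^ 2 * (a ^ 2 - b ^ 3) = a ^ 2 - b := by rw [hs, div_mul_cancel₀ _ hD]
  have hs3 : s ^ 2 * (α ^ 2 - β ^ 3) = α ^ 2 - β := by
    refine mul_left_cancel₀ hD ?_
    linear_combination hrel + (α ^ 2 - β ^ 3) * hs2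
  have hs0 : s ≠ 0 := by
    rintro rfl
    exact hN (by rw [← hs2]; ring)
  have hy0 : y ≠ 0 := by
    rintro rfl
    have h1 : s ^ 2 = 1 := by
      refine mul_left_cancel₀ hs0 ?_
      linear_combination -hy
    -- If `y = 0` then `s² = 1`, which forces `b³ = b`.
    exact hM (by rw [h1] at hs2; linear_combination -hs2)
  let c : TripleRing k →+* K :=
    AffineCurveRing.lift (AffineCurveRing.lift (AffineCurveRing.lift (e.comp (algebraMap k _))
      s y hy) (b * s) (a * y) (by linear_combination a ^ 2 * hy + s * hs2)) (β * s) (α * y)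
      (by linear_combination α ^ 2 * hy + s * hs3)
  have hx₁ : c (x₁ k) = s := by simp [c, x₁]
  have hy₁ : c (y₁ k) = y := by simp [c, y₁]
  have hp : c (x₁ k) * s⁻¹ = 1 := by rw [hx₁, mul_inv_cancel₀ hs0]
  have hq : c (y₁ k) * y⁻¹ = 1 := by rw [hy₁, mul_inv_cancel₀ hy0]
  refine ⟨c, s⁻¹, y⁻¹, hp, hq, ?_⟩
  have : quotientCoords c s⁻¹ y⁻¹ hp hq = e := by
    refine hypersurfaceRing_hom_ext (fun t => ?_) fun j => ?_
    · simp [c, tripleOf]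
    · change quotientCoords c s⁻¹ y⁻¹ hp hq (coord k j) = e (coord k j)
      fin_cases j
      · refine Eq.trans ?_ (mul_inv_cancel_right₀ hy0 a)
        simp [c, y₂, a]
      · refine Eq.trans ?_ (mul_inv_cancel_right₀ hs0 b)
        simp [c, x₂, b]
      · refine Eq.trans ?_ (mul_inv_cancel_right₀ hy0 α)
        simp [c, y₃, α]
      · refine Eq.trans ?_ (mul_inv_cancel_right₀ hs0 β)
        simp [c, x₃, β]
  rw [this]
  exact he

/-- The universal case is the localization `L` at `x₁ y₁`. The geometric point over the generic
point of `H` factors through `L`, which gives injectivity into `L`, and `L` embeds in `T` because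
`c` is injective. -/
lemma quotientCoords_injective (c : TripleRing k →+* T) (p q : T) (hp : c (x₁ k) * p = 1)
    (hq : c (y₁ k) * q = 1) (hc : Function.Injective c) :
    Function.Injective (quotientCoords c p q hp hq) := by
  let L := Localization.Away (x₁ k * y₁ k)
  have hu : IsUnit (algebraMap (TripleRing k) L (x₁ k) * algebraMap (TripleRing k) L (y₁ k)) := by
    rw [← map_mul]
    exact IsLocalization.Away.algebraMap_isUnit _
  obtain ⟨p', hp'⟩ := (isUnit_of_mul_isUnit_left hu).exists_right_inv
  obtain ⟨q', hq'⟩ := (isUnit_of_mul_isUnit_right hu).exists_right_inv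
  have hunit {T' : Type u} [CommRing T'] (c' : TripleRing k →+* T') (p' q' : T')
      (hp' : c' (x₁ k) * p' = 1) (hq' : c' (y₁ k) * q' = 1) : IsUnit (c' (x₁ k * y₁ k)) := by
    rw [map_mul]
    exact (IsUnit.of_mul_eq_one _ hp').mul (IsUnit.of_mul_eq_one _ hq')
  have hL : Function.Injective (quotientCoords (algebraMap _ L) p' q' hp' hq') := by
    obtain ⟨c', p'', q'', hp'', hq'', h⟩ := exists_geometricPoint (k := k)
    rw [← comp_quotientCoords (algebraMap _ L) p' q' hp' hq' (IsLocalization.Away.lift _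
      (hunit c' p'' q'' hp'' hq'')) c' (IsLocalization.Away.lift_eq _ _),
      RingHom.coe_comp] at h
    exact Function.Injective.of_comp h
  rw [← comp_quotientCoords (algebraMap _ L) p' q' hp' hq' (IsLocalization.Away.lift _
      (hunit c p q hp hq)) c (IsLocalization.Away.lift_eq _ _)]
  rw [RingHom.coe_comp]
  refine Function.Injective.comp ?_ hL
  rw [injective_iff_map_eq_zero]
  intro t ht
  obtain ⟨n, r, hr⟩ := IsLocalization.Away.surj (x₁ k * y₁ k) t
  have h2 := congrArg (IsLocalization.Away.lift (S := L) _ (hunit c p q hp hq)) hr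
  rw [map_mul, ht, zero_mul, IsLocalization.Away.lift_eq, eq_comm, map_eq_zero_iff c hc] at h2
  rw [h2, map_zero] at hr
  have hxy := IsLocalization.Away.algebraMap_isUnit (S := L) (x₁ k * y₁ k)
  exact (hxy.pow n).mul_left_eq_zero.mp hr

end TripleRing

end QuotientCoords

/-! ### Invariant functions as fractions on `H`. -/

section InvariantFunctions

/-- The elements that the powers of `D` multiply into the range of a ring homomorphism. -/
def localRange {R T : Type*} [CommRing R] [CommRing T] (κ : R →+* T) (D : R) : Subring T where
  carrier := {t | ∃ (n : ℕ) (h : R), κ h = κ D ^ n * t}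
  mul_mem' := by
    rintro s t ⟨n, g, hg⟩ ⟨m, h, hh⟩
    exact ⟨n + m, g * h, by rw [map_mul, hg, hh]; ring⟩
  one_mem' := ⟨0, 1, by simp⟩
  add_mem' := by
    rintro s t ⟨n, g, hg⟩ ⟨m, h, hh⟩
    exact ⟨n + m, D ^ m * g + D ^ n * h, by
      rw [map_add, map_mul, map_mul, hg, hh, map_pow, map_pow]; ring⟩
  zero_mem' := ⟨0, 0, by simp⟩
  neg_mem' := by
    rintro s ⟨n, g, hg⟩
    exact ⟨n, -g, by rw [map_neg, hg]; ring⟩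

lemma apply_mem_localRange {R T : Type*} [CommRing R] [CommRing T] (κ : R →+* T) (D h : R) :
    κ h ∈ localRange κ D := ⟨0, h, by simp⟩

namespace TripleRing

variable {k : Type u} [Field k] {T : Type u} [CommRing T]

variable (k) in
/-- The denominator of the function `x₁²` on the hypersurface. -/
def denom : HypersurfaceRing k := coord k 0 ^ 2 - coord k 1 ^ 3

section

variable (c : TripleRing k →+* T) (p q : T) (hp : c (x₁ k) * p = 1) (hq : c (y₁ k) * q = 1)

lemma sq_x₁_mem : c (x₁ k) ^ 2 ∈ localRange (quotientCoords c p q hp hq) (denom k) := by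
  refine ⟨1, coord k 0 ^ 2 - coord k 1, ?_⟩
  simp only [denom, map_sub, map_pow, quotientCoords_a, quotientCoords_b, pow_one]
  rw [← sq_mul_eq hp hq (map_relation₁ c) (map_relation₂ c), mul_comm]

/-- Factoring out the ratios leaves `x₁^M y₁^E`. Divisibility by 4 makes `E = 2n` and `M + n` even,
and `y₁² = x₁ (x₁² - 1)` turns this into `x₁^(M + n) (x₁² - 1)ⁿ`, a polynomial in `x₁²`. -/
lemma monomial_mem (t : k) (m₁ e₁ m₂ e₂ m₃ e₃ : ℕ)
    (h : 4 ∣ 2 * (m₁ + m₂ + m₃) + (e₁ + e₂ + e₃)) :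
    c (monomial t m₁ e₁ m₂ e₂ m₃ e₃) ∈ localRange (quotientCoords c p q hp hq) (denom k) := by
  obtain ⟨n, hn⟩ : ∃ n, e₁ + e₂ + e₃ = 2 * n := ⟨(e₁ + e₂ + e₃) / 2, by omega⟩
  obtain ⟨s, hs⟩ : ∃ s, m₁ + m₂ + m₃ + n = 2 * s := ⟨(m₁ + m₂ + m₃ + n) / 2, by omega⟩
  have hx₂ : c (x₂ k) = quotientCoords c p q hp hq (coord k 1) * c (x₁ k) := by
    rw [quotientCoords_b, mul_assoc, mul_comm p, hp, mul_one]
  have hx₃ : c (x₃ k) = quotientCoords c p q hp hq (coord k 3) * c (x₁ k) := by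
    rw [quotientCoords_β, mul_assoc, mul_comm p, hp, mul_one]
  have hy₂ : c (y₂ k) = quotientCoords c p q hp hq (coord k 0) * c (y₁ k) := by
    rw [quotientCoords_a, mul_assoc, mul_comm q, hq, mul_one]
  have hy₃ : c (y₃ k) = quotientCoords c p q hp hq (coord k 2) * c (y₁ k) := by
    rw [quotientCoords_α, mul_assoc, mul_comm q, hq, mul_one]
  have hxy : c (x₁ k) ^ (m₁ + m₂ + m₃) * c (y₁ k) ^ (e₁ + e₂ + e₃) =
      (c (x₁ k) ^ 2) ^ s * (c (x₁ k) ^ 2 - 1) ^ n := by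
    have h3 : c (x₁ k) ^ 3 - c (x₁ k) = c (x₁ k) * (c (x₁ k) ^ 2 - 1) := by ring
    rw [hn, pow_mul, map_relation₁, ← pow_mul, ← hs, pow_add _ _ n, h3, mul_pow, mul_assoc]
  have : c (monomial t m₁ e₁ m₂ e₂ m₃ e₃) = quotientCoords c p q hp hq (algebraMap k _ t *
      coord k 1 ^ m₂ * coord k 0 ^ e₂ * coord k 3 ^ m₃ * coord k 2 ^ e₃) *
        ((c (x₁ k) ^ 2) ^ s * (c (x₁ k) ^ 2 - 1) ^ n) := by
    rw [← hxy, monomial]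
    simp only [map_mul, map_pow, hx₂, hx₃, hy₂, hy₃, quotientCoords_algebraMap]
    ring
  rw [this]
  have h2 := sq_x₁_mem c p q hp hq
  exact mul_mem (apply_mem_localRange _ _ _)
    (mul_mem (pow_mem h2 _) (pow_mem (sub_mem h2 (one_mem _)) _))

/-- An invariant is a quarter of its orbit sum, and orbit sums are additive, so only monomials
matter. -/
lemma mem_localRange_of_invariant (hk : (4 : k) ≠ 0) {i : k} (hi : IsPrimitiveRoot i 4)
    {t : TripleRing k} (ht : tripleTwist hi t = t) :
    c t ∈ localRange (quotientCoords c p q hp hq) (denom k) := by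
  have h : ∀ t, c (orbitSum hi t) ∈ localRange (quotientCoords c p q hp hq) (denom k) := by
    refine induction (fun a b ha hb => ?_) fun r m₁ e₁ m₂ e₂ m₃ e₃ => ?_
    · have : orbitSum hi (a + b) = orbitSum hi a + orbitSum hi b := by
        simp only [orbitSum, map_add]
        ring
      rw [this, map_add]
      exact add_mem ha hb
    · rcases orbitSum_monomial hi r m₁ e₁ m₂ e₂ m₃ e₃ with h | ⟨h4, h⟩
      · rw [h, map_zero]
        exact zero_mem _
      · rw [h]
        exact monomial_mem c p q hp hq _ _ _ _ _ _ _ h4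
  have h4 : t = tripleOf k 4⁻¹ * orbitSum hi t := by
    have : orbitSum hi t = tripleOf k 4 * t := by
      simp only [orbitSum, ht, map_ofNat]
      ring
    rw [this, ← mul_assoc, ← map_mul, inv_mul_cancel₀ hk, map_one, one_mul]
  rw [h4, map_mul, ← quotientCoords_algebraMap c p q hp hq]
  exact mul_mem (apply_mem_localRange _ _ _) (h t)

end

variable (k) in
/-- The product of the functions on the chart of `C × C × C` to be inverted. -/
def disc : TripleRing k :=
  x₁ k * y₁ k * (x₂ k * (x₂ k ^ 2 - x₁ k ^ 2)) * (y₂ k * (x₃ k * (x₁ k ^ 2 - x₃ k ^ 2)))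

variable (k) in
/-- The product of the functions on the hypersurface corresponding to `disc`. -/
def hypersurfaceDisc : HypersurfaceRing k :=
  denom k * (coord k 0 * (coord k 3 * (1 - coord k 3 ^ 2)))

/-- The factors of `disc` are chosen as follows: `x₁ y₁` makes the ratios defined, `x₂ (x₂² - x₁²)`
is `denom` times `x₁² y₁²`, and the remaining ones give `a β (1 - β²)`, half the derivative of the
equation, times powers of `x₁` and `y₁`. -/
lemma map_disc {c : TripleRing k →+* T} {p q : T} (hp : c (x₁ k) * p = 1)
    (hq : c (y₁ k) * q = 1) : c (disc k) =
      quotientCoords c p q hp hq (hypersurfaceDisc k) * (c (x₁ k) ^ 6 * c (y₁ k) ^ 4) := by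
  have h1 : quotientCoords c p q hp hq (denom k) * (c (x₁ k) ^ 2 * c (y₁ k) ^ 2) =
      c (x₂ k) * (c (x₂ k) ^ 2 - c (x₁ k) ^ 2) := by
    simp only [denom, map_sub, map_pow, quotientCoords_a, quotientCoords_b]
    linear_combination c (y₁ k) ^ 2 * sq_mul_eq hp hq (map_relation₁ c) (map_relation₂ c) +
      c (y₂ k) ^ 2 * (c (y₁ k) * q + 1) * hq + map_relation₂ c - c (x₂ k) * p * map_relation₁ c -
      c (x₂ k) * (c (x₁ k) ^ 2 - 1) * hp
  have hx₃ : c (x₃ k) = quotientCoords c p q hp hq (coord k 3) * c (x₁ k) := by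
    rw [quotientCoords_β, mul_assoc, mul_comm p, hp, mul_one]
  have hy₂ : c (y₂ k) = quotientCoords c p q hp hq (coord k 0) * c (y₁ k) := by
    rw [quotientCoords_a, mul_assoc, mul_comm q, hq, mul_one]
  simp only [disc, hypersurfaceDisc, map_mul, map_sub, map_pow, map_one]
  rw [← h1, hx₃, hy₂]
  ring

lemma disc_ne_zero : disc k ≠ 0 := by
  obtain ⟨c, p, q, hp, hq, h⟩ := exists_geometricPoint (k := k)
  intro h0
  have h1 := map_disc hp hq
  have hx : c (x₁ k) ≠ 0 := left_ne_zero_of_mul_eq_one hp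
  have hy : c (y₁ k) ≠ 0 := left_ne_zero_of_mul_eq_one hq
  rw [h0, map_zero, eq_comm, mul_eq_zero_iff_right (mul_ne_zero (pow_ne_zero _ hx)
    (pow_ne_zero _ hy)), map_eq_zero_iff _ h] at h1
  have hβ : diagonal (coord k 3) = Polynomial.X := hypersurfaceLift_X _ _ _ _
  have ha : diagonal (coord k 0) = 1 := hypersurfaceLift_X _ _ _ _
  have h2 := congrArg diagonal ((mul_eq_zero.mp h1).resolve_left coord_nonvanishing.1)
  simp only [map_mul, map_sub, map_pow, map_one, hβ, ha, one_mul, map_zero] at h2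
  have := congrArg (fun p => p.coeff 1) h2
  simp [mul_sub, ← pow_succ', Polynomial.coeff_X_pow] at this

end TripleRing

end InvariantFunctions

/-! ### The ring of invariants as a localization of the coordinate ring of `H`. -/

section InvariantRing

namespace TripleRing

lemma exists_factor {R B S : Type*} [CommRing R] [CommRing B] [CommRing S] (κ : R →+* S)
    (j : B →+* S) (hj : Function.Injective j) (h : ∀ r, ∃ b, j b = κ r) :
    ∃ ψ : R →+* B, ∀ r, j (ψ r) = κ r := by
  let e : B ≃+* j.range := RingEquiv.ofBijective j.rangeRestrict
    ⟨fun a b hab => hj (congrArg Subtype.val hab), j.rangeRestrict_surjective⟩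
  refine ⟨(e.symm : j.range →+* B).comp (κ.codRestrict j.range h), fun r => ?_⟩
  exact congrArg Subtype.val (e.apply_symm_apply (κ.codRestrict j.range h r))

variable {k : Type u} [Field k] {S : Type u} [CommRing S] {i : k} (hi : IsPrimitiveRoot i 4)

lemma quotientCoords_invariant (c : TripleRing k →+* S) (p q : S) (hp : c (x₁ k) * p = 1)
    (hq : c (y₁ k) * q = 1) (γ : S →+* S) (hγ : ∀ t, γ (c t) = c (tripleTwist hi t))
    (h : HypersurfaceRing k) :
    γ (quotientCoords c p q hp hq h) = quotientCoords c p q hp hq h := by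
  have hι : c (tripleOf k i) ^ 2 = -1 := by
    rw [← map_pow, ← map_pow, sq_eq_neg_one hi, map_neg, map_neg, map_one, map_one]
  have h1 : γ p = -p := by
    have := congrArg γ hp
    rw [map_mul, hγ, twist_x₁, map_one, map_neg] at this
    linear_combination (-p) * this - γ p * hp
  have h2 : γ q = -c (tripleOf k i) * q := by
    have := congrArg γ hq
    rw [map_mul, hγ, twist_y₁, map_one, map_mul] at this
    linear_combination (-c (tripleOf k i) * q) * this - γ q * hq +
      q * γ q * c (y₁ k) * hι
  refine DFunLike.congr_fun (f := γ.comp (quotientCoords c p q hp hq))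
    (hypersurfaceRing_hom_ext (fun t => ?_) fun j => ?_) h
  · simp [hγ, twist_of]
  · change γ (quotientCoords c p q hp hq (coord k j)) = quotientCoords c p q hp hq (coord k j)
    fin_cases j
    · simp only [Fin.zero_eta, quotientCoords_a, map_mul, hγ, twist_y₂, h2]
      linear_combination (-c (y₂ k) * q) * hι
    · simp only [Fin.mk_one, quotientCoords_b, map_mul, hγ, twist_x₂, h1, map_neg]
      ring
    · simp only [Fin.reduceFinMk, quotientCoords_α, map_mul, hγ, twist_y₃, h2]
      linear_combination (-c (y₃ k) * q) * hι
    · simp only [Fin.reduceFinMk, quotientCoords_β, map_mul, hγ, twist_x₃, h1, map_neg]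
      ring

/-- The ring of invariants of a suitable localization of the coordinate ring of the chart of
`C × C × C` is a localization of the coordinate ring of the hypersurface, smooth over `k`. -/
lemma exists_isLocalization (hk : (2 : k) ≠ 0) {B : Type u} [CommRing B]
    (c : TripleRing k →+* S) (hc : Function.Injective c) (f : TripleRing k) (hdf : disc k ∣ f)
    (hf : tripleTwist hi f = f) (hunit : IsUnit (c f))
    (hsurj : ∀ s, ∃ (n : ℕ) (t : TripleRing k), s * c f ^ n = c t)
    (γ : S →+* S) (hγ : ∀ t, γ (c t) = c (tripleTwist hi t))
    (j : B →+* S) (hj : Function.Injective j) (hB : ∀ s, (∃ b, j b = s) ↔ γ s = s) :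
    ∃ ψ : HypersurfaceRing k →+* B,
      (∃ r : HypersurfaceRing k, letI := ψ.toAlgebra; IsLocalization.Away r B) ∧
      (∀ t, j (ψ (algebraMap k _ t)) = c (tripleOf k t)) ∧
      (ψ.comp (algebraMap k (HypersurfaceRing k))).Smooth := by
  have hdisc : IsUnit (c (disc k)) := isUnit_of_dvd_unit (map_dvd c hdf) hunit
  have hxy : IsUnit (c (x₁ k) * c (y₁ k)) := by
    rw [disc, map_mul, map_mul, map_mul] at hdisc
    exact isUnit_of_mul_isUnit_left (isUnit_of_mul_isUnit_left hdisc)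
  obtain ⟨p, hp⟩ := (isUnit_of_mul_isUnit_left hxy).exists_right_inv
  obtain ⟨q, hq⟩ := (isUnit_of_mul_isUnit_right hxy).exists_right_inv
  set κ := quotientCoords c p q hp hq with hκ
  have hκinj : Function.Injective κ := quotientCoords_injective c p q hp hq hc
  have hκγ (h) : γ (κ h) = κ h := quotientCoords_invariant hi c p q hp hq γ hγ h
  obtain ⟨ψ, hψ⟩ := exists_factor κ j hj fun r => (hB _).mpr (hκγ r)
  -- The inverse of an invariant unit of `S` is again invariant, so it lies in `B`.
  have hψunit {h : HypersurfaceRing k} (hh : IsUnit (κ h)) : IsUnit (ψ h) := by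
    obtain ⟨s, hs⟩ := hh.exists_right_inv
    have hs' : γ s = s := by
      have := congrArg γ hs
      rw [map_mul, hκγ, map_one] at this
      linear_combination s * this - γ s * hs
    obtain ⟨b, hb⟩ := (hB s).mpr hs'
    exact IsUnit.of_mul_eq_one b (hj (by rw [map_mul, hψ, hb, hs, map_one]))
  have hk4 : (4 : k) ≠ 0 := by
    have : (4 : k) = 2 * 2 := by norm_num
    rw [this]
    exact mul_ne_zero hk hk
  have hκdisc : IsUnit (κ (hypersurfaceDisc k)) := by
    rw [map_disc hp hq] at hdisc
    exact isUnit_of_mul_isUnit_left hdisc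
  rw [hypersurfaceDisc, map_mul] at hκdisc
  have hκD : IsUnit (κ (denom k)) := isUnit_of_mul_isUnit_left hκdisc
  have hderiv : IsUnit (ψ (hypersurfaceDeriv k)) := by
    refine hψunit ?_
    rw [hypersurfaceDeriv, mul_assoc, map_mul]
    refine IsUnit.mul ?_ (isUnit_of_mul_isUnit_right hκdisc)
    have := ((IsUnit.mk0 _ hk).map (algebraMap k (HypersurfaceRing k))).map κ
    rwa [map_ofNat] at this
  obtain ⟨m, φ, hφ⟩ := mem_localRange_of_invariant c p q hp hq hk4 hi hf
  -- Since `κ φ` is `f` times a power of the denominator, inverting `φ * denom k` inverts both `f`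
  -- and the denominator.
  have hr : IsUnit (κ (φ * denom k)) := by
    rw [map_mul, hκ, hφ]
    exact ((hκD.pow m).mul hunit).mul hκD
  have hloc : letI := ψ.toAlgebra; IsLocalization.Away (φ * denom k) B := by
    let := ψ.toAlgebra
    refine ⟨?_, ?_, ?_⟩
    · rintro ⟨_, n, rfl⟩
      change IsUnit (ψ ((φ * denom k) ^ n))
      rw [map_pow]
      exact (hψunit hr).pow n
    · intro b
      obtain ⟨n, t, ht⟩ := hsurj (j b)
      have hbinv : γ (j b) = j b := (hB _).mp ⟨b, rfl⟩
      have hinv : tripleTwist hi t = t := by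
        apply hc
        rw [← hγ, ← ht, map_mul, map_pow, hbinv, hγ, hf]
      obtain ⟨l, τ, hτ⟩ := mem_localRange_of_invariant c p q hp hq hk4 hi hinv
      -- With `D` the denominator, `j b = t / fⁿ`, `κ φ = D^m f` and `κ τ = D^l t`; multiplying `b`
      -- by `(φ D)^(n + l)` clears both `fⁿ` and `D^l`.
      refine ⟨(denom k ^ (m * n) * τ * φ ^ l * denom k ^ n, ⟨_, n + l, rfl⟩), ?_⟩
      apply hj
      change j (b * ψ ((φ * denom k) ^ (n + l))) = j (ψ _)
      rw [map_mul, hψ, hψ]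
      simp only [map_mul, map_pow]
      rw [← hκ] at hφ hτ
      rw [hτ, ← ht, hφ]
      ring
    · intro g h hgh
      refine ⟨1, ?_⟩
      have : ψ g = ψ h := hgh
      rw [hκinj (a₁ := g) (a₂ := h) (by rw [← hψ, ← hψ, this])]
  refine ⟨ψ, ⟨_, hloc⟩, fun t => by rw [hψ, hκ, quotientCoords_algebraMap], ?_⟩
  let := ψ.toAlgebra
  let := (ψ.comp (algebraMap k (HypersurfaceRing k))).toAlgebra
  have : IsScalarTower k (HypersurfaceRing k) B :=
    IsScalarTower.of_algebraMap_eq' (R := k) (S := HypersurfaceRing k) (A := B) rfl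
  exact smooth_of_isUnit_hypersurfaceDeriv (φ * denom k) hderiv

end TripleRing

end InvariantRing

/-! ### The common open subscheme of the quotient and `H`. -/

section Assembly

lemma exists_iso_opensRange {A : Type u} [CommRing A] {Z : Scheme.{u}} (j : Spec (.of A) ⟶ Z)
    [IsOpenImmersion j] : ∃ (W : Z.Opens) (hW : IsAffineOpen W) (ε : Γ(Z, W) ≅ .of A),
      W = j.opensRange ∧ Spec.map ε.hom ≫ hW.fromSpec = j := by
  have hW := isAffineOpen_opensRange j
  let e : Spec (.of A) ≅ Spec Γ(Z, j.opensRange) :=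
    IsOpenImmersion.isoOfRangeEq j hW.fromSpec (by rw [hW.range_fromSpec]; rfl)
  have he : e.hom ≫ hW.fromSpec = j := IsOpenImmersion.isoOfRangeEq_hom_fac _ _ _
  refine ⟨_, hW, ⟨Spec.preimage e.hom, Spec.preimage e.inv, ?_, ?_⟩, rfl, ?_⟩
  · apply Spec.map_injective
    simp
  · apply Spec.map_injective
    simp
  · simpa using he

variable {k : Type u} [Field k]

/-- Choose `V` affine with preimage the principal open `D(f)` of the triple chart, `f` an invariant
multiple of `disc`. Sections on `V` are then the invariants of the ring localized at `f`, a smooth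
localization of the coordinate ring of `H`. -/
lemma exists_chart_of_isCyclicQuotient (hk : (2 : k) ≠ 0) {i : k} (hi : IsPrimitiveRoot i 4)
    {Y : Scheme.{u}} {q : triple k ⟶ Y} (hq : IsCyclicQuotient (tripleAut i hi) q)
    (sY : Y ⟶ Spec (.of k)) (hs : q ≫ sY = tripleToSpec k) :
    ∃ (V : Y.Opens) (m : V.toScheme ⟶ hypersurface k), (V : Set Y).Nonempty ∧ IsOpenImmersion m ∧
      m ≫ hypersurfaceToSpec k = V.ι ≫ sY ∧ Smooth (V.ι ≫ sY) := by
  set g := tripleAut i hi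
  obtain ⟨W, hW, ε, hWj, hε⟩ := exists_iso_opensRange (tripleChart k)
  have hgW : W ≤ g ⁻¹ᵁ W := by
    rw [hWj]
    rintro _ ⟨y, rfl⟩
    refine ⟨Spec.map (CommRingCat.ofHom (tripleTwist hi)) y, ?_⟩
    rw [← Scheme.Hom.comp_apply, ← Scheme.Hom.comp_apply, tripleChart_tripleAut]
  have hθ : g.appLE W W hgW ≫ ε.hom = ε.hom ≫ CommRingCat.ofHom (tripleTwist hi) := by
    apply Spec.map_injective
    rw [← cancel_mono hW.fromSpec, Spec.map_comp, Spec.map_comp, Category.assoc, Category.assoc,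
      hW.SpecMap_appLE_fromSpec g hW hgW, reassoc_of% hε, hε, tripleChart_tripleAut]
  have hdomain : IsDomain Γ(triple k, W) := ε.commRingCatIsoToRingEquiv.toMulEquiv.isDomain _
  have hne : ((triple k).basicOpen (ε.inv (TripleRing.disc k)) : Set (triple k)).Nonempty := by
    rw [Set.nonempty_iff_ne_empty, ← TopologicalSpace.Opens.coe_bot, ne_eq,
      TopologicalSpace.Opens.coe_inj,
      ← Scheme.isNilpotent_iff_basicOpen_eq_bot_of_isCompact hW.isCompact, isNilpotent_iff_eq_zero]
    exact fun h => TripleRing.disc_ne_zero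
      ((map_eq_zero_iff _ ε.symm.commRingCatIsoToRingEquiv.injective).mp h)
  obtain ⟨f, V, hV, hqV, hdf, hf, hfne⟩ := hq.exists_isAffineOpen (tripleAut_pow_four hi) hW hgW
    (ε.inv (TripleRing.disc k)) hne
  have hf0 : f ≠ 0 := by
    rintro rfl
    simp at hfne
  have hle : q ⁻¹ᵁ V ≤ W := hqV.le.trans ((triple k).basicOpen_le f)
  have hO : IsAffineOpen (q ⁻¹ᵁ V) := hqV ▸ hW.basicOpen f
  let res : Γ(triple k, W) ⟶ Γ(triple k, q ⁻¹ᵁ V) := (triple k).presheaf.map (homOfLE hle).op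
  have hloc : letI := res.hom.toAlgebra; IsLocalization.Away f Γ(triple k, q ⁻¹ᵁ V) :=
    hW.isLocalization_of_eq_basicOpen f (homOfLE hle) hqV
  have hres : Function.Injective res := by
    let := res.hom.toAlgebra
    exact IsLocalization.injective _ (M := Submonoid.powers f)
      (powers_le_nonZeroDivisors_of_noZeroDivisors hf0)
  have hunit : IsUnit (res f) := by
    let := res.hom.toAlgebra
    exact IsLocalization.Away.algebraMap_isUnit f
  have hsurj (s : Γ(triple k, q ⁻¹ᵁ V)) : ∃ (n : ℕ) (t : Γ(triple k, W)),
      s * res f ^ n = res t := by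
    let := res.hom.toAlgebra
    exact IsLocalization.Away.surj f s
  let c := ε.inv ≫ res
  have hεε (t) : ε.inv (ε.hom t) = t := congrArg (fun m => m.hom t) ε.hom_inv_id
  have hεε' (t) : ε.hom (ε.inv t) = t := congrArg (fun m => m.hom t) ε.inv_hom_id
  have hcε (t) : c.hom (ε.hom t) = res t := congrArg res (hεε t)
  have hcspec : Spec.map c ≫ tripleChart k = hO.fromSpec := by
    have h : ε.hom ≫ c = res := ε.hom_inv_id_assoc _
    rw [← hε, ← Spec.map_comp_assoc, h]
    exact hW.map_fromSpec hO _
  let γ := g.appLE (q ⁻¹ᵁ V) (q ⁻¹ᵁ V) (hq.le_preimage V)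
  have hγ : c ≫ γ = CommRingCat.ofHom (tripleTwist hi) ≫ c := by
    have h : ε.inv ≫ g.appLE W W hgW = CommRingCat.ofHom (tripleTwist hi) ≫ ε.inv := by
      rw [Iso.inv_comp_eq, ← reassoc_of% hθ, ε.hom_inv_id, Category.comp_id]
    rw [← reassoc_of% h, Category.assoc]
    simp only [γ, res, Scheme.Hom.map_appLE, Scheme.Hom.appLE_map]
  have hdvd : TripleRing.disc k ∣ ε.hom f := by
    have := map_dvd ε.hom.hom hdf
    rwa [hεε'] at this
  have hinv : tripleTwist hi (ε.hom f) = ε.hom f := by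
    have : ε.hom (g.appLE W W hgW f) = tripleTwist hi (ε.hom f) :=
      congrArg (fun m => m.hom f) hθ
    rw [← this, hf]
  obtain ⟨ψ, ⟨r, hr⟩, hψ, hsmooth⟩ := TripleRing.exists_isLocalization hi hk c.hom
    (hres.comp ε.symm.commRingCatIsoToRingEquiv.injective) (ε.hom f)
    hdvd hinv (by rw [hcε]; exact hunit) (fun s => by
      obtain ⟨n, t, ht⟩ := hsurj s
      exact ⟨n, ε.hom t, by rw [hcε, hcε, ht]⟩) γ.hom (fun t => congrArg (fun m => m.hom t) hγ)
    (q.app V).hom (hq.app_injective V) (hq.exists_app_eq_iff V)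
  let m : Spec Γ(Y, V) ⟶ hypersurface k := Spec.map (CommRingCat.ofHom ψ)
  have hm : IsOpenImmersion m := by
    let := ψ.toAlgebra
    exact IsOpenImmersion.of_isLocalization r
  have hsY : hV.fromSpec ≫ sY =
      Spec.map (CommRingCat.ofHom (ψ.comp (algebraMap k (HypersurfaceRing k)))) := by
    have h : Spec.preimage (hV.fromSpec ≫ sY) ≫ q.app V = CommRingCat.ofHom (tripleOf k) ≫ c := by
      apply Spec.map_injective
      rw [Spec.map_comp, Spec.map_comp, Spec.map_preimage, ← tripleChart_toSpec,
        reassoc_of% hcspec, ← hs, Scheme.Hom.app_eq_appLE,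
        ← hV.SpecMap_appLE_fromSpec_assoc q hO le_rfl]
    rw [← Spec.map_preimage (hV.fromSpec ≫ sY)]
    congr 1
    ext t
    -- Compatibility over `k` is checked after pulling back to `C × C × C`, which loses nothing
    -- because functions on `Y` embed in functions upstairs.
    apply hq.app_injective V
    exact (congrArg (fun m => m.hom t) h).trans (hψ t).symm
  have hsY' : V.ι ≫ sY = hV.isoSpec.hom ≫
      Spec.map (CommRingCat.ofHom (ψ.comp (algebraMap k (HypersurfaceRing k)))) := by
    rw [← hsY, hV.isoSpec_hom_fromSpec_assoc]
  have hmk : m ≫ hypersurfaceToSpec k =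
      Spec.map (CommRingCat.ofHom (ψ.comp (algebraMap k (HypersurfaceRing k)))) :=
    (Spec.map_comp _ _).symm
  refine ⟨V, hV.isoSpec.hom ≫ m, ?_, ?_, ?_, ?_⟩
  · obtain ⟨z, hz⟩ := hfne
    rw [← hqV] at hz
    exact ⟨q z, hz⟩
  · infer_instance
  · rw [hsY', Category.assoc, hmk]
  · have : Smooth (Spec.map (CommRingCat.ofHom (ψ.comp (algebraMap k (HypersurfaceRing k))))) :=
      (HasRingHomProperty.Spec_iff (P := @Smooth)).mpr hsmooth
    rw [hsY']
    infer_instance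

end Assembly

end UenoCampana

end

theorem mainTheorem2 {k : Type u} [Field k] (hk : ringChar k ≠ 2) (i : k)
    (hi : IsPrimitiveRoot i 4) (W : UenoCampana.Threefold i hi) :
    Ideal.span {UenoCampana.hypersurfacePoly k} = Ideal.span {UenoCampana.hypersurfacePoly' k} ∧
    UenoCampana.IsConicBundle (UenoCampana.projection k) ∧
    ∃ φ : Scheme.PartialIso W.X (UenoCampana.hypersurface k),
      φ.IsOver W.toSpec (UenoCampana.hypersurfaceToSpec k) ∧
      UenoCampana.IsBirationallyConicBundle
        (φ.toPartialMap.compHom (UenoCampana.projection k)) := by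
  refine ⟨by rw [UenoCampana.hypersurfacePoly_eq], UenoCampana.isConicBundle_projection k, ?_⟩
  obtain ⟨V, m, hne, hm, hmk, hsmooth⟩ := UenoCampana.exists_chart_of_isCyclicQuotient
    (Ring.two_ne_zero hk) hi W.isCyclicQuotient W.quotToSpec W.quot_toSpec
  have := W.isCyclicQuotient.irreducibleSpace
  -- `V` is smooth, hence contained in the largest smooth open and disjoint from the blown-up
  -- singular points.
  have hV : ∀ y ∈ V, y ∉ (Scheme.IdealSheafData.vanishingIdeal
      (UenoCampana.singularLocus W.quotToSpec)).support := by
    intro y hy hsing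
    have hsing' : y ∈ (UenoCampana.singularLocus W.quotToSpec : Set W.Y) := by
      rwa [← Scheme.IdealSheafData.coe_support_vanishingIdeal]
    have hle : V ≤ UenoCampana.smoothOpens W.quotToSpec := le_sSup hsmooth
    exact hsing' (hle hy)
  have hiso := W.isBlowUp.isIso_morphismRestrict hV
  have hdense := W.isBlowUp.dense_preimage hne
  obtain ⟨y, hy⟩ := hne
  have : Nonempty (W.blowUp ⁻¹ᵁ V) :=
    ⟨inv (W.blowUp ∣_ V) ⟨y, hy⟩⟩
  refine UenoCampana.exists_partialIso W.toSpec (W.blowUp ⁻¹ᵁ V) hdense (W.blowUp ∣_ V ≫ m) ?_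
  rw [Category.assoc, hmk, morphismRestrict_ι_assoc]
  rfl
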